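/- Let $n,h\ge 0$, $D\ge 0$ and $K\ge 1$ be integers, let $v_1,\dots,v_K\in\mathbb{C}^{2^n}$ and $\ell_1,\dots,\ell_K\in\mathbb{C}^2$ be unit vectors, and let $\mathcal{H}_1,\dots,\mathcal{H}_D$ be matrices on $\mathbb{C}^{2^n}\otimes\mathbb{C}^{2^h}\otimes\mathbb{C}^2$, each of them both Hermitian and unitary. For $\omega\in\mathbb{R}^D$ put $\mathcal{H}(\omega)=\sum_{i=1}^D\omega_i\mathcal{H}_i$, let $P_{\ell_k}=1\otimes 1\otimes|\ell_k\rangle\langle\ell_k|$, and assume $[P_{\ell_k},\mathcal{H}_i]=0$ for all $k$ and $i$. Let $H'_k=(\langle v_k|\otimes 1)\,\mathcal{H}(\omega)\,(|v_k\rangle\otimes 1)$, an operator on $\mathbb{C}^{2^h}\otimes\mathbb{C}^2$, and $$\langle A\rangle_k=\frac{\mathrm{Tr}\left[A\left(|v_k\rangle\langle v_k|\otimes e^{H'_k}\right)\right]}{\mathrm{Tr}\,e^{H'_k}},\qquad \tau_k=\frac{e^{H'_k}}{\mathrm{Tr}\,e^{H'_k}},$$ $$g=\left(\frac1K\sum_{k=1}^K\left[\langle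 P_{\ell_k}\mathcal{H}_i\rangle_k-\langle P_{\ell_k}\rangle_k\langle\mathcal{H}_i\rangle_k\right]\right)_{i=1}^D .$$ Algorithms are quantum query algorithms on a finite-dimensional system: they may use arbitrary oracle-independent quantum operations and measurements, with classical control, and one counts the oracle queries in the worst case. An algorithm may depend on $n,h,D,K,\varepsilon$ and the matrices $\mathcal{H}_i$ (and on the dimension of $B$ in (b)), but not on $\omega$, the data $v_k,\ell_k$ or the oracles. There is a universal constant $C>0$ such that for every $\varepsilon>0$: (a) Suppose that one can query, for each $k$, a unitary $F(k)$ with $F(k)|0\rangle=|v_k\rangle|\ell_k\rangle$, its inverse, and an oracle $G_k$ that prepares a copy of the state $\tau_k$. Then some algorithm that makes at most $C\,D^2/\varepsilon^2$ queries outputs, with probability at least $2/3$, a vector in $\mathbb{R}^D$ within Euclidean distance $\varepsilon$ of $g$. (b) Suppose that one can query $\sum_k|k\rangle\langle k|\otimes F(k)$ with $F(k)$ as in (a), a unitary $G$ with $G|k\rangle|0\rangle=|k\rangle|\psi_k\rangle$ for all $k$, where $\psi_k\in(\mathbb{C}^{2^h}\otimes\mathbb{C}^2)\otimes B$ is a purification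 of $\tau_k$ and $B$ is a finite-dimensional auxiliary space, and the inverses of both. Then some algorithm that makes at most $C\,D^2/\varepsilon$ queries outputs, with probability at least $2/3$, a vector in $\mathbb{R}^D$ within Euclidean distance $\varepsilon$ of $g$. -/

import Mathlib

open Matrix Kronecker

noncomputable section

/-- The computational basis labels of `m` qubits, so that functions `Qubits m → ℂ` form the
space `ℂ^(2^m)`; the label `0` is the basis state `|0…0⟩`. -/
abbrev Qubits (m : ℕ) : Type := Fin m → Fin 2

/-- Basis labels of the hidden register together with the label qubit, `ℂ^(2^h) ⊗ ℂ^2`. -/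
abbrev Hid (h : ℕ) : Type := Qubits h × Fin 2

/-- Basis labels of the full space `ℂ^(2^n) ⊗ (ℂ^(2^h) ⊗ ℂ^2)`. -/
abbrev Full (n h : ℕ) : Type := Qubits n × Hid h

/-- The basis vector `|r⟩`. -/
def ket {R : Type} [DecidableEq R] (r : R) : R → ℂ := Pi.single r 1

/-- The rank-one operator `|φ⟩⟨φ|`. -/
def ketbra {R : Type} (φ : R → ℂ) : Matrix R R ℂ := vecMulVec φ (star φ)

/-! ### The supervised Boltzmann machine -/

/-- The Harmony operator `ℋ(ω) = ∑ᵢ ωᵢ ℋᵢ`. -/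
def harmony {D n h : ℕ} (H : Fin D → Matrix (Full n h) (Full n h) ℂ) (ω : Fin D → ℝ) :
    Matrix (Full n h) (Full n h) ℂ :=
  ∑ i, (ω i : ℂ) • H i

/-- The conditional Harmony operator `H' = (⟨v| ⊗ 1) ℋ (|v⟩ ⊗ 1)` on the hidden and label
registers, in the computational basis. -/
def condHarmony {n h : ℕ} (ℋ : Matrix (Full n h) (Full n h) ℂ)
    (v : EuclideanSpace ℂ (Qubits n)) : Matrix (Hid h) (Hid h) ℂ :=
  Matrix.of fun x y => ∑ a, ∑ b, star (v a) * ℋ (a, x) (b, y) * v b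

/-- The Gibbs state `e^A / Tr e^A`. -/
def gibbs {R : Type} [Fintype R] [DecidableEq R] (A : Matrix R R ℂ) : Matrix R R ℂ :=
  (trace (NormedSpace.exp A))⁻¹ • NormedSpace.exp A

/-- The label projector `P_ℓ = 1 ⊗ 1 ⊗ |ℓ⟩⟨ℓ|`. -/
def labelProj (n h : ℕ) (ℓ : EuclideanSpace ℂ (Fin 2)) : Matrix (Full n h) (Full n h) ℂ :=
  (1 : Matrix (Qubits n) (Qubits n) ℂ) ⊗ₖ
    ((1 : Matrix (Qubits h) (Qubits h) ℂ) ⊗ₖ ketbra ℓ)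

/-- `⟨A⟩ = Tr[A (|v⟩⟨v| ⊗ e^{H'})] / Tr e^{H'}`, where `H'` is the conditional Harmony operator
of `ℋ` given `v`. -/
def condExp {n h : ℕ} (ℋ : Matrix (Full n h) (Full n h) ℂ) (v : EuclideanSpace ℂ (Qubits n))
    (A : Matrix (Full n h) (Full n h) ℂ) : ℂ :=
  trace (A * (ketbra v ⊗ₖ NormedSpace.exp (condHarmony ℋ v))) /
    trace (NormedSpace.exp (condHarmony ℋ v))

/-- The vector with components `𝔼ₖ[⟨P_{ℓₖ} ℋᵢ⟩ₖ - ⟨P_{ℓₖ}⟩ₖ ⟨ℋᵢ⟩ₖ]`, `𝔼ₖ` being the average over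
the `K` training examples. -/
def gradVec {D n h K : ℕ} (H : Fin D → Matrix (Full n h) (Full n h) ℂ) (ω : Fin D → ℝ)
    (v : Fin K → EuclideanSpace ℂ (Qubits n)) (ℓ : Fin K → EuclideanSpace ℂ (Fin 2)) :
    EuclideanSpace ℂ (Fin D) :=
  WithLp.toLp 2 fun i => (1 / (K : ℂ)) * ∑ k,
    (condExp (harmony H ω) (v k) (labelProj n h (ℓ k) * H i) -
      condExp (harmony H ω) (v k) (labelProj n h (ℓ k)) * condExp (harmony H ω) (v k) (H i))

/-! ### Quantum query algorithms -/

/-- What one query does to the register `R` it is applied to: it acts by a (unitary) gate, or it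
discards the content of `R` and prepares a fresh copy of the state `τ`. -/
inductive OracleAction (R : Type) : Type
  | gate (U : Matrix R R ℂ)
  | prepare (τ : Matrix R R ℂ)

/-- The action of a query on a state `ρ` of a larger system `S`, where `e` exhibits `R` as a
tensor factor of `S`: `ρ ↦ (U ⊗ 1) ρ (U ⊗ 1)†` for a gate, `ρ ↦ τ ⊗ Tr_R ρ` for a preparation. -/
def OracleAction.apply {S R T : Type} [Fintype S] [Fintype R] [DecidableEq T] (e : S ≃ R × T) :
    OracleAction R → Matrix S S ℂ → Matrix S S ℂ
  | .gate U, ρ =>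
      (U ⊗ₖ (1 : Matrix T T ℂ)).submatrix e e * ρ * ((U ⊗ₖ (1 : Matrix T T ℂ)).submatrix e e)ᴴ
  | .prepare τ, ρ =>
      (τ ⊗ₖ (Matrix.of fun t t' => ∑ r, ρ (e.symm (r, t)) (e.symm (r, t')))).submatrix e e

/-- Quantum query programs on a system with basis labels `S`, with query symbols `q : Q` acting on
registers `R q` and with outputs in `Out`. A program either stops with a classical output, or
performs a measurement with Kraus operators `M j` (this includes unitary gates, resets and coin
flips) and continues depending on the outcome `j`, or makes a query on some tensor factor of the
system. The program text does not refer to the answers of the oracles. -/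
inductive QProgram (S : Type) [Fintype S] [DecidableEq S] {Q : Type} (R : Q → Type)
    (Out : Type) : Type 1
  | output (o : Out) : QProgram S R Out
  | measure {m : ℕ} (M : Fin m → Matrix S S ℂ) (hM : ∑ j, (M j)ᴴ * M j = 1)
      (next : Fin m → QProgram S R Out) : QProgram S R Out
  | query (q : Q) (T : Type) [Fintype T] [DecidableEq T] (e : S ≃ R q × T)
      (next : QProgram S R Out) : QProgram S R Out

/-- The largest number of queries made in any run. -/
def QProgram.queries {S : Type} [Fintype S] [DecidableEq S] {Q : Type} {R : Q → Type}
    {Out : Type} : QProgram S R Out → ℕ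
  | .output _ => 0
  | .measure _ _ next => Finset.univ.sup fun j => (next j).queries
  | @QProgram.query _ _ _ _ _ _ _ _ _ _ _ next => next.queries + 1

/-- The probability that the program, started in the state `ρ` and with the oracles acting as
`ans`, stops with an output in `good`. (An outcome `j` turns `ρ` into the unnormalized state
`M j ρ (M j)†`, whose trace carries its probability.) -/
def QProgram.prob {S : Type} [Fintype S] [DecidableEq S] {Q : Type} {R : Q → Type}
    [∀ q, Fintype (R q)] {Out : Type} (ans : ∀ q, OracleAction (R q)) (good : Set Out) :
    QProgram S R Out → Matrix S S ℂ → ℝ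
  | .output o, ρ => good.indicator (fun _ => (trace ρ).re) o
  | .measure M _ next, ρ => ∑ j, (next j).prob ans good (M j * ρ * (M j)ᴴ)
  | @QProgram.query _ _ _ _ _ _ q _ _ _ e next, ρ => next.prob ans good ((ans q).apply e ρ)

/-- A quantum query algorithm: a finite-dimensional system, a basis state in which it starts, and
a program on it. -/
structure QueryAlgorithm {Q : Type} (R : Q → Type) (Out : Type) : Type 1 where
  S : Type
  [fintypeS : Fintype S]
  [decEqS : DecidableEq S]
  start : S
  program : QProgram S R Out

attribute [instance] QueryAlgorithm.fintypeS QueryAlgorithm.decEqS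

/-- The largest number of queries that the algorithm makes. -/
def QueryAlgorithm.queries {Q : Type} {R : Q → Type} {Out : Type}
    (𝒜 : QueryAlgorithm R Out) : ℕ :=
  𝒜.program.queries

/-- The probability that the algorithm's output lies in `good`. -/
def QueryAlgorithm.prob {Q : Type} {R : Q → Type} [∀ q, Fintype (R q)] {Out : Type}
    (𝒜 : QueryAlgorithm R Out) (ans : ∀ q, OracleAction (R q)) (good : Set Out) : ℝ :=
  𝒜.program.prob ans good (ketbra (ket 𝒜.start))

/-! ### The oracles -/

/-- `F(k)` is a unitary with `F(k)|0⟩ = |v_k⟩|ℓ_k⟩`, for every `k`. -/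
def IsDataOracle {n K : ℕ} (v : Fin K → EuclideanSpace ℂ (Qubits n))
    (ℓ : Fin K → EuclideanSpace ℂ (Fin 2))
    (F : Fin K → Matrix (Qubits n × Fin 2) (Qubits n × Fin 2) ℂ) : Prop :=
  ∀ k, F k ∈ Matrix.unitaryGroup (Qubits n × Fin 2) ℂ ∧
    F k *ᵥ ket 0 = fun p => v k p.1 * ℓ k p.2

/-- Query symbols when Gibbs states are supplied as copies; the index `k` is classical. -/
inductive SampleQuery (K : ℕ) : Type
  | F (k : Fin K)
  | Finv (k : Fin K)
  | G (k : Fin K)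

/-- The register that each query acts on. -/
abbrev SampleQuery.reg (n h : ℕ) {K : ℕ} : SampleQuery K → Type
  | .F _ => Qubits n × Fin 2
  | .Finv _ => Qubits n × Fin 2
  | .G _ => Hid h

instance SampleQuery.fintypeReg (n h : ℕ) {K : ℕ} : ∀ q : SampleQuery K, Fintype (q.reg n h)
  | .F _ => inferInstanceAs (Fintype (Qubits n × Fin 2))
  | .Finv _ => inferInstanceAs (Fintype (Qubits n × Fin 2))
  | .G _ => inferInstanceAs (Fintype (Hid h))

/-- The oracles `F(k)`, `F(k)†`, and the preparation `G_k` of a copy of the state `τ k`. -/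
def sampleOracle {n h K : ℕ} (F : Fin K → Matrix (Qubits n × Fin 2) (Qubits n × Fin 2) ℂ)
    (τ : Fin K → Matrix (Hid h) (Hid h) ℂ) :
    ∀ q : SampleQuery K, OracleAction (q.reg n h)
  | .F k => .gate (F k)
  | .Finv k => .gate (F k)ᴴ
  | .G k => .prepare (τ k)

/-- `ψ ∈ A ⊗ B` is a purification of `τ`: `Tr_B |ψ⟩⟨ψ| = τ`. -/
def IsPurification {A B : Type} [Fintype B] (τ : Matrix A A ℂ) (ψ : A × B → ℂ) : Prop :=
  ∀ a a', ∑ b, ketbra ψ (a, b) (a', b) = τ a a'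

/-- `G` is a unitary with `G|k⟩|0⟩ = |k⟩|ψ_k⟩` for every `k`, where `ψ_k ∈ A ⊗ B` is a
purification of `τ k` and `B` is an auxiliary space of dimension `d`. -/
def IsPurifiedOracle {h K d : ℕ} [NeZero d] (τ : Fin K → Matrix (Hid h) (Hid h) ℂ)
    (G : Matrix (Fin K × (Hid h × Fin d)) (Fin K × (Hid h × Fin d)) ℂ) : Prop :=
  G ∈ Matrix.unitaryGroup (Fin K × (Hid h × Fin d)) ℂ ∧
    ∃ ψ : Fin K → Hid h × Fin d → ℂ, ∀ k,
      IsPurification (τ k) (ψ k) ∧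
        G *ᵥ ket (k, 0) = fun p => ket k p.1 * ψ k p.2

/-- The family `F` as one unitary `∑ₖ |k⟩⟨k| ⊗ F(k)` with a quantum index register. -/
def coherent {K : ℕ} {R : Type} (F : Fin K → Matrix R R ℂ) :
    Matrix (Fin K × R) (Fin K × R) ℂ :=
  Matrix.of fun p q => if p.1 = q.1 then F p.1 p.2 q.2 else 0

/-- Query symbols when purified Gibbs states are supplied; the index is in superposition. -/
inductive PurifiedQuery : Type
  | F
  | Finv
  | G
  | Ginv

/-- The register that each query acts on. -/
abbrev PurifiedQuery.reg (n h K d : ℕ) : PurifiedQuery → Type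
  | .F => Fin K × (Qubits n × Fin 2)
  | .Finv => Fin K × (Qubits n × Fin 2)
  | .G => Fin K × (Hid h × Fin d)
  | .Ginv => Fin K × (Hid h × Fin d)

instance PurifiedQuery.fintypeReg (n h K d : ℕ) :
    ∀ q : PurifiedQuery, Fintype (q.reg n h K d)
  | .F => inferInstanceAs (Fintype (Fin K × (Qubits n × Fin 2)))
  | .Finv => inferInstanceAs (Fintype (Fin K × (Qubits n × Fin 2)))
  | .G => inferInstanceAs (Fintype (Fin K × (Hid h × Fin d)))
  | .Ginv => inferInstanceAs (Fintype (Fin K × (Hid h × Fin d)))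

/-- The oracles `∑ₖ |k⟩⟨k| ⊗ F(k)` and `G`, and their inverses. -/
def purifiedOracle {n h K d : ℕ}
    (F : Fin K → Matrix (Qubits n × Fin 2) (Qubits n × Fin 2) ℂ)
    (G : Matrix (Fin K × (Hid h × Fin d)) (Fin K × (Hid h × Fin d)) ℂ) :
    ∀ q : PurifiedQuery, OracleAction (q.reg n h K d)
  | .F => .gate (coherent F)
  | .Finv => .gate (coherent F)ᴴ
  | .G => .gate G
  | .Ginv => .gate Gᴴ

/-- The real vectors within Euclidean distance `ε` of `g`. -/
def approximations {D : ℕ} (g : EuclideanSpace ℂ (Fin D)) (ε : ℝ) :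
    Set (EuclideanSpace ℝ (Fin D)) :=
  {x | ‖WithLp.toLp 2 (fun i => (x i : ℂ)) - g‖ ≤ ε}

end

/-! Let C_i be the compression of ℋ_i to the data state v_k and let P be the label projector on the
hidden and label registers. Since P_ℓ acts trivially on the data register, component i of g is the
average over k of the covariances Tr(P C_i τ) - Tr(P τ) Tr(C_i τ), and these are real because P and
C_i commute (`gradVec_eq`).

For (a), a random k and one sample of P_ℓ ℋ_i minus the product of independent samples of P_ℓ and
ℋ_i give an unbiased estimator of component i. It costs 10 queries, and its second moment is at most
4 because ℋ_i squares to 1 (`exists_hasLaw_sampleCov`). With means of order D/ε² runs for each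
component, the mean square errors add up to at most ε²/3, and Markov's inequality gives success
probability 2/3 (`exists_queryAlgorithm`).

For (b), the averaged covariance is exactly one expectation value c = ⟨Uχ|Z|Uχ⟩ of a Hermitian
unitary Z = `covObs`, where U = `prepUnitary` costs 5 queries (`star_dotProduct_covObs_mulVec`). Put
W = U†ZU and Q = W(2|χ⟩⟨χ| - 1). The vectors u_m = Q^m χ satisfy the Chebyshev recursion u_{m+2} +
u_m = 2c u_{m+1}. So a superposition of the |u_m⟩|m⟩, with slowly varying weights that vanish at
both ends, is nearly an eigenvector with eigenvalue c of half the adjacency matrix of the path of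
counter values. Measuring that observable estimates c with mean square error at most 60/M² for M
rounds (`exists_hasLaw_estimateAmplitude`); order D/ε rounds for each component suffice.

The laws of the estimators do not depend on the initial state, so programs compose as independent
experiments; their laws are positive linear functionals (`Expectation`). If ε is large compared with
√D, the zero vector is already a valid answer and no query is made. -/

open scoped ComplexOrder

noncomputable section

/-! ### Block operators on tensor factors -/

/-- The operator acting on the tensor factor `R` by `B t` when the other factor is in the basis
state `t`. -/
def blockOp {S R T : Type} [DecidableEq T] (e : S ≃ R × T) (B : T → Matrix R R ℂ) :
    Matrix S S ℂ :=
  (blockDiagonal B).submatrix e e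

theorem blockOp_apply {S R T : Type} [DecidableEq T] (e : S ≃ R × T) (B : T → Matrix R R ℂ)
    (s s' : S) :
    blockOp e B s s' = if (e s).2 = (e s').2 then B (e s).2 (e s).1 (e s').1 else 0 := by
  simp [blockOp, blockDiagonal_apply]

theorem kronecker_one_submatrix {S R T : Type} [DecidableEq T] (e : S ≃ R × T)
    (U : Matrix R R ℂ) :
    (U ⊗ₖ (1 : Matrix T T ℂ)).submatrix e e = blockOp e fun _ => U := by
  rw [blockOp, kronecker_one]

theorem blockOp_mul {S R T : Type} [Fintype S] [Fintype R] [Fintype T] [DecidableEq T]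
    (e : S ≃ R × T) (B B' : T → Matrix R R ℂ) :
    blockOp e B * blockOp e B' = blockOp e fun t => B t * B' t := by
  rw [blockOp, blockOp, blockOp, submatrix_mul_equiv, blockDiagonal_mul]

theorem blockOp_conjTranspose {S R T : Type} [DecidableEq T]
    (e : S ≃ R × T) (B : T → Matrix R R ℂ) :
    (blockOp e B)ᴴ = blockOp e fun t => (B t)ᴴ := by
  rw [blockOp, blockOp, conjTranspose_submatrix, blockDiagonal_conjTranspose]

theorem blockOp_one {S R T : Type} [DecidableEq S] [DecidableEq R] [DecidableEq T]
    (e : S ≃ R × T) : blockOp e (fun _ => (1 : Matrix R R ℂ)) = 1 := by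
  have h := blockDiagonal_one (m := R) (o := T) (α := ℂ)
  rw [Pi.one_def] at h
  rw [blockOp, h, submatrix_one_equiv]

theorem blockOp_mulVec {S R T : Type} [Fintype S] [Fintype R] [Fintype T] [DecidableEq T]
    (e : S ≃ R × T) (B : T → Matrix R R ℂ) (φ : S → ℂ) (s : S) :
    (blockOp e B *ᵥ φ) s = ∑ r, B (e s).2 (e s).1 r * φ (e.symm (r, (e s).2)) := by
  rw [mulVec, dotProduct, ← e.symm.sum_comp, Fintype.sum_prod_type]
  refine Finset.sum_congr rfl fun r _ => ?_
  rw [Finset.sum_eq_single (e s).2]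
  · simp [blockOp_apply]
  · intro t _ ht
    simp [blockOp_apply, ht.symm]
  · simp

theorem blockOp_conjTranspose_mul_self {S R T : Type} [Fintype S] [Fintype R] [Fintype T]
    [DecidableEq S] [DecidableEq R] [DecidableEq T]
    (e : S ≃ R × T) (B : T → Matrix R R ℂ) (hB : ∀ t, (B t)ᴴ * B t = 1) :
    (blockOp e B)ᴴ * blockOp e B = 1 := by
  simp only [blockOp_conjTranspose, blockOp_mul, hB, blockOp_one]

/-! ### Rank-one operators -/

theorem mul_ketbra_mul {S S' : Type} [Fintype S] (A : Matrix S' S ℂ) (φ : S → ℂ) :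
    A * ketbra φ * Aᴴ = ketbra (A *ᵥ φ) := by
  rw [ketbra, ketbra, mul_vecMulVec, vecMulVec_mul, star_mulVec]

theorem trace_ketbra {S : Type} [Fintype S] (φ : S → ℂ) : trace (ketbra φ) = star φ ⬝ᵥ φ := by
  rw [ketbra, trace_vecMulVec, dotProduct_comm]

theorem trace_mul_ketbra {S : Type} [Fintype S] (A : Matrix S S ℂ) (φ : S → ℂ) :
    trace (A * ketbra φ) = star φ ⬝ᵥ A *ᵥ φ := by
  rw [ketbra, mul_vecMulVec, trace_vecMulVec, dotProduct_comm]

theorem posSemidef_ketbra {S : Type} [Fintype S] (φ : S → ℂ) : (ketbra φ).PosSemidef :=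
  posSemidef_vecMulVec_self_star φ

theorem isHermitian_ketbra {S : Type} (φ : S → ℂ) : (ketbra φ).IsHermitian := by
  ext i j
  simp [ketbra, vecMulVec_apply, mul_comm]

theorem ketbra_mul_ketbra {S : Type} [Fintype S] {φ : S → ℂ} (h : star φ ⬝ᵥ φ = 1) :
    ketbra φ * ketbra φ = ketbra φ := by
  rw [ketbra, vecMulVec_mul_vecMulVec, h, one_smul]

theorem star_ket_dotProduct_ket {S : Type} [Fintype S] [DecidableEq S] (s : S) :
    star (ket s) ⬝ᵥ ket s = 1 := by
  simp [ket]

/-! ### Oracle actions -/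

/-- The action is a quantum channel: the gate is unitary, the prepared matrix is a state. -/
def OracleAction.IsChannel {R : Type} [Fintype R] : OracleAction R → Prop
  | .gate U => ∃ _ : DecidableEq R, Uᴴ * U = 1
  | .prepare τ => τ.PosSemidef ∧ τ.trace = 1

theorem OracleAction.apply_smul {S R T : Type} [Fintype S] [Fintype R] [DecidableEq T]
    (e : S ≃ R × T) (a : OracleAction R) (c : ℂ) (ρ : Matrix S S ℂ) :
    a.apply e (c • ρ) = c • a.apply e ρ := by
  cases a with
  | gate U => simp [OracleAction.apply]
  | prepare τ =>
    ext s s'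
    simp only [OracleAction.apply, submatrix_apply, kroneckerMap_apply, of_apply,
      Matrix.smul_apply, smul_eq_mul, ← Finset.mul_sum]
    ring

theorem OracleAction.posSemidef_apply {S R T : Type} [Fintype S] [Fintype R] [Fintype T]
    [DecidableEq T] (e : S ≃ R × T) {a : OracleAction R} (ha : a.IsChannel) {ρ : Matrix S S ℂ}
    (hρ : ρ.PosSemidef) : (a.apply e ρ).PosSemidef := by
  cases a with
  | gate U => exact hρ.mul_mul_conjTranspose_same _
  | prepare τ =>
    refine PosSemidef.submatrix (PosSemidef.kronecker ha.1 ?_) _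
    -- The partial trace is a sum of principal submatrices of ρ, each of them positive semidefinite.
    have : (of fun t t' => ∑ r, ρ (e.symm (r, t)) (e.symm (r, t')) : Matrix T T ℂ)
        = ∑ r, ρ.submatrix (fun t => e.symm (r, t)) (fun t => e.symm (r, t)) := by
      ext t t'
      simp [Matrix.sum_apply]
    rw [this]
    exact posSemidef_sum _ fun r _ => hρ.submatrix _

theorem OracleAction.trace_apply {S R T : Type} [Fintype S] [Fintype R] [Fintype T]
    [DecidableEq T] (e : S ≃ R × T) {a : OracleAction R} (ha : a.IsChannel) (ρ : Matrix S S ℂ) :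
    trace (a.apply e ρ) = trace ρ := by
  classical
  cases a with
  | gate U =>
    obtain ⟨i, hU⟩ := ha
    -- `IsChannel` carries its own decidable equality, which is identified with the classical one so
    -- that the identity matrices agree.
    obtain rfl : i = fun a b => Classical.propDecidable (a = b) := Subsingleton.elim _ _
    rw [OracleAction.apply, kronecker_one_submatrix, trace_mul_comm, ← mul_assoc,
      blockOp_conjTranspose_mul_self _ _ fun _ => hU, one_mul]
  | prepare τ =>
    have h1 : ∀ M : Matrix (R × T) (R × T) ℂ, trace (M.submatrix e e) = trace M := fun M => by
      simpa [trace] using e.sum_comp fun i => M i i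
    rw [OracleAction.apply, h1, trace_kronecker, ha.2, one_mul, trace, trace,
      ← e.symm.sum_comp, Fintype.sum_prod_type_right]
    simp

namespace QProgram

variable {S Q : Type} [Fintype S] [DecidableEq S] {R : Q → Type} {α β : Type}

/-! ### Sequential composition -/

/-- Run `p`, then the program selected by its output. -/
def bind : QProgram S R α → (α → QProgram S R β) → QProgram S R β
  | .output o, g => g o
  | .measure M hM next, g => .measure M hM fun j => (next j).bind g
  | @QProgram.query _ _ _ _ _ _ q T _ _ e next, g => .query q T e (next.bind g)

theorem queries_bind_le {n m : ℕ} {p : QProgram S R α} {g : α → QProgram S R β}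
    (hp : p.queries ≤ m) (hg : ∀ a, (g a).queries ≤ n) : (p.bind g).queries ≤ m + n := by
  induction p generalizing m with
  | output o => exact (hg o).trans (Nat.le_add_left _ _)
  | measure M hM next ih =>
    refine Finset.sup_le fun j _ => ih j ?_
    exact (Finset.le_sup (f := fun j => (next j).queries) (Finset.mem_univ j)).trans hp
  | query q T e next ih =>
    simp only [queries, bind] at hp ⊢
    have := ih (m := m - 1) (by omega)
    omega

/-- Discard the current state and prepare the pure state `φ`. -/
def prep (φ : S → ℂ) (hφ : star φ ⬝ᵥ φ = 1) (next : QProgram S R α) : QProgram S R α :=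
  -- The Kraus operators are |φ⟩⟨s|, one for each basis state s; every outcome leaves the state φ.
  .measure (fun j : Fin (Fintype.card S) => vecMulVec φ (ket ((Fintype.equivFin S).symm j))) (by
    rw [(Fintype.equivFin S).symm.sum_comp
      fun s => (vecMulVec φ (ket s))ᴴ * vecMulVec φ (ket s)]
    ext s s'
    simp only [conjTranspose_vecMulVec, vecMulVec_mul_vecMulVec, hφ, one_smul, Matrix.sum_apply,
      vecMulVec_apply, ket]
    simp [Pi.single_apply, Matrix.one_apply]) fun _ => next

theorem queries_prep_le (φ : S → ℂ) (hφ : star φ ⬝ᵥ φ = 1) (next : QProgram S R α) :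
    (prep φ hφ next).queries ≤ next.queries :=
  Finset.sup_le fun _ _ => le_rfl

/-! ### Expected values of program outputs -/

variable [∀ q, Fintype (R q)]

/-- The expected value of `f` at the output (weighted by the trace of the initial state). -/
def expect {Out : Type} (ans : ∀ q, OracleAction (R q)) (f : Out → ℝ) :
    QProgram S R Out → Matrix S S ℂ → ℂ
  | .output o, ρ => f o * trace ρ
  | .measure M _ next, ρ => ∑ j, (next j).expect ans f (M j * ρ * (M j)ᴴ)
  | @QProgram.query _ _ _ _ _ _ q _ _ _ e next, ρ => next.expect ans f ((ans q).apply e ρ)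

variable {ans : ∀ q, OracleAction (R q)}

theorem prob_eq_re_expect (good : Set α) (p : QProgram S R α) (ρ : Matrix S S ℂ) :
    p.prob ans good ρ = (p.expect ans (good.indicator 1) ρ).re := by
  induction p generalizing ρ with
  | output o =>
    by_cases h : o ∈ good <;> simp [prob, expect, h]
  | measure M hM next ih => simp [prob, expect, ih]
  | query q T e next ih => simp [prob, expect, ih]

theorem expect_smul (f : α → ℝ) (p : QProgram S R α) (c : ℂ) (ρ : Matrix S S ℂ) :
    p.expect ans f (c • ρ) = c * p.expect ans f ρ := by
  induction p generalizing ρ with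
  | output o => simp [expect]; ring
  | measure M hM next ih => simp [expect, ih, Finset.mul_sum]
  | query q T e next ih => simp [expect, ih, OracleAction.apply_smul]

theorem expect_add_fun (f g : α → ℝ) (p : QProgram S R α) (ρ : Matrix S S ℂ) :
    p.expect ans (f + g) ρ = p.expect ans f ρ + p.expect ans g ρ := by
  induction p generalizing ρ with
  | output o => simp [expect]; ring
  | measure M hM next ih => simp [expect, ih, Finset.sum_add_distrib]
  | query q T e next ih => simp [expect, ih]

theorem expect_smul_fun (c : ℝ) (f : α → ℝ) (p : QProgram S R α) (ρ : Matrix S S ℂ) :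
    p.expect ans (c • f) ρ = c * p.expect ans f ρ := by
  induction p generalizing ρ with
  | output o => simp [expect]; ring
  | measure M hM next ih => simp [expect, ih, Finset.mul_sum]
  | query q T e next ih => simp [expect, ih]

theorem expect_nonneg (hans : ∀ q, (ans q).IsChannel) {f : α → ℝ} (hf : 0 ≤ f)
    (p : QProgram S R α) {ρ : Matrix S S ℂ} (hρ : ρ.PosSemidef) : 0 ≤ p.expect ans f ρ := by
  induction p generalizing ρ with
  | output o => exact mul_nonneg (by exact_mod_cast hf o) hρ.trace_nonneg
  | measure M hM next ih =>
    exact Finset.sum_nonneg fun j _ => ih j (hρ.mul_mul_conjTranspose_same _)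
  | query q T e next ih => exact ih (OracleAction.posSemidef_apply e (hans q) hρ)

theorem expect_one (hans : ∀ q, (ans q).IsChannel) (p : QProgram S R α) (ρ : Matrix S S ℂ) :
    p.expect ans 1 ρ = trace ρ := by
  induction p generalizing ρ with
  | output o => simp [expect]
  | measure M hM next ih =>
    simp only [expect, ih]
    simp_rw [fun j => trace_mul_comm (M j * ρ) (M j)ᴴ, ← mul_assoc, ← trace_sum,
      ← Finset.sum_mul, hM, one_mul]
  | query q T e next ih =>
    simp only [expect, ih]
    exact OracleAction.trace_apply e (hans q) ρ

/-- Nonnegativity in the order of ℂ includes being real; a general `f` is the difference of its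
positive and negative parts. -/
theorem expect_im (hans : ∀ q, (ans q).IsChannel) (f : α → ℝ)
    (p : QProgram S R α) {ρ : Matrix S S ℂ} (hρ : ρ.PosSemidef) : (p.expect ans f ρ).im = 0 := by
  have h : f = (f ⊔ 0) + (-1 : ℝ) • (-f ⊔ 0) := by
    ext a
    rcases le_total (f a) 0 with h | h <;> simp [h]
  have h1 := expect_nonneg hans (f := f ⊔ 0) le_sup_right p hρ
  have h2 := expect_nonneg hans (f := -f ⊔ 0) le_sup_right p hρ
  rw [Complex.nonneg_iff] at h1 h2
  rw [h, expect_add_fun, expect_smul_fun]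
  simp [← h1.2, ← h2.2]

/-- The hypothesis says that the continuation sees nothing of the state left behind except its
weight. This is what makes consecutive runs independent. -/
theorem expect_bind {E : α → ℝ} {f : β → ℝ} {p : QProgram S R α} {g : α → QProgram S R β}
    (hg : ∀ a ρ, (g a).expect ans f ρ = E a * trace ρ) (ρ : Matrix S S ℂ) :
    (p.bind g).expect ans f ρ = p.expect ans E ρ := by
  induction p generalizing ρ with
  | output o => exact hg o ρ
  | measure M hM next ih => simp [expect, bind, ih]
  | query q T e next ih => simp [expect, bind, ih]

/-- Only the trace of the old state survives a reset, so everything after it has a law of its own.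
-/
theorem expect_prep (f : α → ℝ) (φ : S → ℂ) (hφ : star φ ⬝ᵥ φ = 1) (next : QProgram S R α)
    (ρ : Matrix S S ℂ) :
    (prep φ hφ next).expect ans f ρ = next.expect ans f (ketbra φ) * trace ρ := by
  have h : ∀ s : S, vecMulVec φ (ket s) * ρ * (vecMulVec φ (ket s))ᴴ = ρ s s • ketbra φ := by
    intro s
    rw [conjTranspose_vecMulVec, vecMulVec_mul, vecMulVec_mul_vecMulVec, ketbra]
    simp [ket]
  simp only [prep, expect, h, expect_smul]
  rw [(Fintype.equivFin S).symm.sum_comp fun s => ρ s s * expect ans f next (ketbra φ),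
    ← Finset.sum_mul, mul_comm, trace]
  rfl

end QProgram

/-! ### Expectation functionals -/

/-- A normalized positive linear functional on the real functions on `X`. -/
structure Expectation (X : Type) where
  toLinearMap : (X → ℝ) →ₗ[ℝ] ℝ
  nonneg : ∀ f, 0 ≤ f → 0 ≤ toLinearMap f
  one : toLinearMap 1 = 1

namespace Expectation

instance (X : Type) : CoeFun (Expectation X) fun _ => (X → ℝ) → ℝ := ⟨fun E => E.toLinearMap⟩

variable {X Y : Type}

theorem mono (E : Expectation X) {f g : X → ℝ} (h : ∀ x, f x ≤ g x) : E f ≤ E g := by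
  have := E.nonneg (g - f) fun x => sub_nonneg.2 (h x)
  rwa [map_sub, sub_nonneg] at this

theorem map_const (E : Expectation X) (c : ℝ) : E (fun _ => c) = c := by
  have : (fun _ => c : X → ℝ) = c • 1 := by ext; simp
  rw [this, map_smul, E.one, smul_eq_mul, mul_one]

theorem map_const_mul (E : Expectation X) (c : ℝ) (f : X → ℝ) :
    E (fun x => c * f x) = c * E f :=
  E.toLinearMap.map_smul c f

theorem map_add' (E : Expectation X) (f g : X → ℝ) :
    E (fun x => f x + g x) = E f + E g :=
  E.toLinearMap.map_add f g

theorem map_quadratic (E : Expectation ℝ) (a b c : ℝ) :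
    E (fun x => a * x ^ 2 + b * x + c) = a * E (fun x => x ^ 2) + b * E id + c := by
  rw [map_add', map_add', map_const_mul, map_const_mul, map_const]
  rfl

theorem map_sub_sq (E : Expectation ℝ) (g : ℝ) :
    E (fun x => (x - g) ^ 2) = E (fun x => x ^ 2) - 2 * g * E id + g ^ 2 := by
  rw [show (fun x : ℝ => (x - g) ^ 2) = fun x => 1 * x ^ 2 + (-2 * g) * x + g ^ 2 by
    ext x; ring, map_quadratic]
  ring

theorem sq_map_id_le (E : Expectation ℝ) : E id ^ 2 ≤ E (fun x => x ^ 2) := by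
  have h := E.nonneg (fun x => (x - E id) ^ 2) fun x => sq_nonneg _
  rw [map_sub_sq] at h
  nlinarith

/-- The point mass at `x`. -/
def pure (x : X) : Expectation X where
  toLinearMap := LinearMap.proj x
  nonneg _ hf := hf x
  one := rfl

@[simp] theorem pure_apply (x : X) (f : X → ℝ) : pure x f = f x := rfl

/-- The law of the second step of a two-step experiment. -/
def bind (E : Expectation X) (F : X → Expectation Y) : Expectation Y where
  toLinearMap := E.toLinearMap ∘ₗ LinearMap.pi fun x => (F x).toLinearMap
  nonneg f hf := E.nonneg _ fun x => (F x).nonneg f hf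
  one := by
    have : (LinearMap.pi fun x => (F x).toLinearMap) 1 = 1 := by ext x; exact (F x).one
    rw [LinearMap.comp_apply, this, E.one]

@[simp] theorem bind_apply (E : Expectation X) (F : X → Expectation Y) (f : Y → ℝ) :
    E.bind F f = E fun x => F x f := rfl

end Expectation

/-! ### Independent runs and their mean square errors -/

namespace QProgram

variable {S Q : Type} [Fintype S] [DecidableEq S] {R : Q → Type} {α β : Type}

/-- The sum of the outputs of `n` runs. -/
def sumRuns (p : QProgram S R ℝ) : ℕ → QProgram S R ℝ
  | 0 => .output 0
  | n + 1 => p.bind fun x => (sumRuns p n).bind fun y => .output (x + y)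

/-- The outputs of one run of each program. -/
def runAll : {D : ℕ} → (Fin D → QProgram S R ℝ) → QProgram S R (Fin D → ℝ)
  | 0, _ => .output ![]
  | _ + 1, p => (p 0).bind fun x => (runAll fun i => p i.succ).bind fun y =>
      .output (Fin.cons x y)

theorem queries_sumRuns_le {m : ℕ} {p : QProgram S R ℝ} (hp : p.queries ≤ m) (n : ℕ) :
    (sumRuns p n).queries ≤ n * m := by
  induction n with
  | zero => exact Nat.zero_le _
  | succ n ih =>
    refine (queries_bind_le hp fun x => queries_bind_le ih fun y => le_refl 0).trans ?_
    rw [Nat.succ_mul]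
    omega

theorem queries_runAll_le {m D : ℕ} {p : Fin D → QProgram S R ℝ} (hp : ∀ i, (p i).queries ≤ m) :
    (runAll p).queries ≤ D * m := by
  induction D with
  | zero => exact Nat.zero_le _
  | succ D ih =>
    refine (queries_bind_le (hp 0) fun x =>
      queries_bind_le (ih fun i => hp i.succ) fun y => le_refl 0).trans ?_
    rw [Nat.succ_mul]
    omega

/-- The mean of the outputs of `n` runs. -/
def meanRuns (p : QProgram S R ℝ) (n : ℕ) : QProgram S R ℝ :=
  (sumRuns p n).bind fun x => .output (x / n)

theorem queries_meanRuns_le {m : ℕ} {p : QProgram S R ℝ} (hp : p.queries ≤ m) (n : ℕ) :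
    (meanRuns p n).queries ≤ n * m :=
  queries_bind_le (n := 0) (queries_sumRuns_le hp n) fun _ => le_refl 0

variable [∀ q, Fintype (R q)] {ans : ∀ q, OracleAction (R q)}

/-- Whatever the initial state, the output of `p` is distributed according to `E`. -/
def HasLaw (ans : ∀ q, OracleAction (R q)) (p : QProgram S R α) (E : Expectation α) : Prop :=
  ∀ f ρ, p.expect ans f ρ = E f * trace ρ

theorem hasLaw_output (a : α) : HasLaw ans (.output a : QProgram S R α) (.pure a) :=
  fun _ _ => rfl

theorem HasLaw.bind {p : QProgram S R α} {E : Expectation α} {g : α → QProgram S R β}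
    {F : α → Expectation β} (hp : HasLaw ans p E) (hg : ∀ a, HasLaw ans (g a) (F a)) :
    HasLaw ans (p.bind g) (E.bind F) := fun f ρ => by
  rw [expect_bind (fun a ρ => hg a f ρ), hp]
  rfl

/-- The law is the real part of `expect` on the prepared state; no information is lost, since the
imaginary part vanishes. Positivity and normalization come from the oracles being channels. -/
theorem exists_hasLaw_prep (hans : ∀ q, (ans q).IsChannel) (φ : S → ℂ) (hφ : star φ ⬝ᵥ φ = 1)
    (next : QProgram S R α) :
    ∃ E, HasLaw ans (prep φ hφ next) E ∧ ∀ f, (E f : ℂ) = next.expect ans f (ketbra φ) := by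
  have hre : ∀ f, ((next.expect ans f (ketbra φ)).re : ℂ) = next.expect ans f (ketbra φ) :=
    fun f => Complex.ext rfl (by simp [expect_im hans f next (posSemidef_ketbra φ)])
  refine ⟨⟨⟨⟨fun f => (next.expect ans f (ketbra φ)).re, ?_⟩, ?_⟩, ?_, ?_⟩, ?_, ?_⟩
  · intro f g
    simp [expect_add_fun]
  · intro c f
    simp [expect_smul_fun]
  · intro f hf
    exact (Complex.nonneg_iff.1 (expect_nonneg hans hf next (posSemidef_ketbra φ))).1
  · simp [expect_one hans, trace_ketbra, hφ]
  · intro f ρ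
    rw [expect_prep]
    exact congrArg (· * trace ρ) (hre f).symm
  · exact hre

/-- Variances of independent runs add: given the first output, the sum of the others has mean `n * E
id`, so the cross term vanishes. -/
theorem exists_hasLaw_sumRuns {p : QProgram S R ℝ} {E : Expectation ℝ} (hp : HasLaw ans p E)
    (n : ℕ) : ∃ F, HasLaw ans (sumRuns p n) F ∧ F id = n * E id ∧
      F (fun x => (x - n * E id) ^ 2) = n * E (fun x => (x - E id) ^ 2) := by
  induction n with
  | zero => exact ⟨_, hasLaw_output 0, by simp, by simp⟩
  | succ n ih =>
    obtain ⟨F, hF, h1, h2⟩ := ih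
    refine ⟨_, hp.bind fun x => hF.bind fun y => hasLaw_output (x + y), ?_, ?_⟩
    · have h : ∀ x, F (fun y => x + y) = x + n * E id := fun x => by
        rw [← h1, F.map_add' (fun _ => x) (fun y => y), F.map_const]
        rfl
      simp only [Expectation.bind_apply, Expectation.pure_apply, id, h]
      rw [E.map_add' (fun x => x), E.map_const]
      push_cast
      change E id + _ = _
      ring
    · have h : ∀ x, F (fun y => (x + y - ((n + 1 : ℕ) : ℝ) * E id) ^ 2)
          = (x - E id) ^ 2 + n * E (fun x => (x - E id) ^ 2) := fun x => by
        rw [← h2, F.map_sub_sq, h1, show (fun y => (x + y - ((n + 1 : ℕ) : ℝ) * E id) ^ 2)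
          = fun y => (y - (((n + 1 : ℕ) : ℝ) * E id - x)) ^ 2 by ext y; ring, F.map_sub_sq, h1]
        push_cast
        ring
      simp only [Expectation.bind_apply, Expectation.pure_apply, h]
      rw [E.map_add', E.map_const]
      push_cast
      ring

/-- Each squared error involves a single coordinate, so linearity suffices. The target `g` is
arbitrary, which leaves room for biased estimators such as those of amplitude estimation. -/
theorem exists_hasLaw_runAll {D : ℕ} {p : Fin D → QProgram S R ℝ} {E : Fin D → Expectation ℝ}
    (hp : ∀ i, HasLaw ans (p i) (E i)) (g : Fin D → ℝ) :
    ∃ F, HasLaw ans (runAll p) F ∧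
      F (fun x => ∑ i, (x i - g i) ^ 2) = ∑ i, E i (fun x => (x - g i) ^ 2) := by
  induction D with
  | zero => exact ⟨_, hasLaw_output _, by simp⟩
  | succ D ih =>
    obtain ⟨F, hF, h⟩ := ih (fun i => hp i.succ) fun i => g i.succ
    refine ⟨_, (hp 0).bind fun x => hF.bind (F := fun y =>
      .pure (Fin.cons (α := fun _ => ℝ) x y)) fun y => hasLaw_output _, ?_⟩
    simp only [Expectation.bind_apply, Expectation.pure_apply, Fin.sum_univ_succ, Fin.cons_zero,
      Fin.cons_succ]
    simp only [Expectation.map_add', Expectation.map_const, h]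

theorem exists_hasLaw_meanRuns {p : QProgram S R ℝ} {E : Expectation ℝ} (hp : HasLaw ans p E)
    {n : ℕ} (hn : 0 < n) : ∃ F, HasLaw ans (meanRuns p n) F ∧
      F (fun x => (x - E id) ^ 2) = E (fun x => (x - E id) ^ 2) / n := by
  obtain ⟨F, hF, -, h⟩ := exists_hasLaw_sumRuns hp n
  refine ⟨_, hF.bind fun x => hasLaw_output (x / n), ?_⟩
  have hn' : (n : ℝ) ≠ 0 := by positivity
  have : (fun x : ℝ => (x / n - E id) ^ 2) = fun x => (1 / (n : ℝ) ^ 2) * (x - n * E id) ^ 2 := by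
    ext x; field_simp
  simp only [Expectation.bind_apply, Expectation.pure_apply, this]
  rw [F.map_const_mul, h]
  field_simp

end QProgram

/-- Estimators of the components of `g` whose mean square errors add up to at most `ε² / 3`
combine into an algorithm that approximates `g` up to `ε` with probability at least `2 / 3`. -/
theorem exists_queryAlgorithm {S Q : Type} [Fintype S] [DecidableEq S] (s : S) {R : Q → Type}
    [∀ q, Fintype (R q)] {D m : ℕ} (p : Fin D → QProgram S R ℝ) (hp : ∀ i, (p i).queries ≤ m)
    {ε : ℝ} (hε : 0 < ε) :
    ∃ 𝒜 : QueryAlgorithm R (EuclideanSpace ℝ (Fin D)), 𝒜.queries ≤ D * m ∧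
      ∀ (ans : ∀ q, OracleAction (R q)) (E : Fin D → Expectation ℝ) (g : Fin D → ℝ),
        (∀ i, (p i).HasLaw ans (E i)) → ∑ i, E i (fun x => (x - g i) ^ 2) ≤ ε ^ 2 / 3 →
        2 / 3 ≤ 𝒜.prob ans (approximations (WithLp.toLp 2 fun i => (g i : ℂ)) ε) := by
  refine ⟨⟨S, s, (QProgram.runAll p).bind fun x => .output (WithLp.toLp 2 x)⟩,
    QProgram.queries_bind_le (n := 0) (QProgram.queries_runAll_le hp) fun _ => le_refl 0, ?_⟩
  intro ans E g hE hg
  obtain ⟨F, hF, h⟩ := QProgram.exists_hasLaw_runAll hE g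
  rw [← h] at hg
  rw [QueryAlgorithm.prob, QProgram.prob_eq_re_expect,
    hF.bind (fun x => QProgram.hasLaw_output (WithLp.toLp 2 x)), trace_ketbra,
    star_ket_dotProduct_ket, mul_one, Complex.ofReal_re]
  simp only [Expectation.bind_apply, Expectation.pure_apply]
  -- Markov's inequality in functional form: the indicator of success dominates 1 minus the squared
  -- error divided by ε².
  have hle : F (fun x => 1 + (-1 / ε ^ 2) * ∑ i, (x i - g i) ^ 2) ≤
      F (fun x => (approximations (WithLp.toLp 2 fun i => (g i : ℂ)) ε).indicator 1
        (WithLp.toLp 2 x)) := by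
    refine F.mono fun x => ?_
    have hs : 0 ≤ ∑ i, (x i - g i) ^ 2 := Finset.sum_nonneg fun i _ => sq_nonneg _
    by_cases hx : WithLp.toLp 2 x ∈ approximations (WithLp.toLp 2 fun i => (g i : ℂ)) ε
    · rw [Set.indicator_of_mem hx, Pi.one_apply]
      have : 0 ≤ 1 / ε ^ 2 * ∑ i, (x i - g i) ^ 2 := by positivity
      rw [neg_div, neg_mul]
      linarith
    · rw [Set.indicator_of_notMem hx]
      rw [approximations, Set.mem_ofPred_eq, not_le, EuclideanSpace.norm_eq,
        Real.lt_sqrt hε.le] at hx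
      have hx' : ε ^ 2 < ∑ i, (x i - g i) ^ 2 := by
        refine hx.trans_eq (Finset.sum_congr rfl fun i _ => ?_)
        simp only [PiLp.sub_apply]
        rw [← Complex.ofReal_sub, Complex.norm_real, Real.norm_eq_abs, sq_abs]
      have : 1 < 1 / ε ^ 2 * ∑ i, (x i - g i) ^ 2 := by
        rw [one_div_mul_eq_div, lt_div_iff₀ (by positivity)]
        linarith
      rw [neg_div, neg_mul]
      linarith
  refine le_trans ?_ hle
  rw [F.map_add' (fun _ => 1), F.map_const, F.map_const_mul]
  have : 1 / ε ^ 2 * F (fun x => ∑ i, (x i - g i) ^ 2) ≤ 1 / 3 := by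
    rw [one_div_mul_eq_div, div_le_iff₀ (by positivity)]
    linarith
  rw [neg_div, neg_mul]
  linarith

/-! ### Measuring a Hermitian observable -/

/-- The spectral decomposition, for a function of the eigenvalues. -/
theorem Matrix.IsHermitian.sum_smul_ketbra {S : Type} [Fintype S] [DecidableEq S]
    {O : Matrix S S ℂ} (hO : O.IsHermitian) (f : ℝ → ℝ) :
    ∑ s, (f (hO.eigenvalues s) : ℂ) • ketbra (hO.eigenvectorBasis s).ofLp =
      (hO.eigenvectorUnitary : Matrix S S ℂ) *
        diagonal (fun s => (f (hO.eigenvalues s) : ℂ)) *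
          star (hO.eigenvectorUnitary : Matrix S S ℂ) := by
  ext i j
  rw [Matrix.mul_apply, Matrix.sum_apply]
  refine Finset.sum_congr rfl fun s _ => ?_
  simp only [Matrix.smul_apply, smul_eq_mul, ketbra, vecMulVec_apply, Pi.star_apply, mul_diagonal,
    star_apply, IsHermitian.eigenvectorUnitary_apply]
  ring

theorem Matrix.IsHermitian.sum_ketbra {S : Type} [Fintype S] [DecidableEq S]
    {O : Matrix S S ℂ} (hO : O.IsHermitian) :
    ∑ s, ketbra (hO.eigenvectorBasis s).ofLp = 1 := by
  have h := hO.sum_smul_ketbra fun _ => 1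
  simpa using h

theorem Matrix.IsHermitian.sum_eigenvalues_smul_ketbra {S : Type} [Fintype S] [DecidableEq S]
    {O : Matrix S S ℂ} (hO : O.IsHermitian) :
    ∑ s, (hO.eigenvalues s : ℂ) • ketbra (hO.eigenvectorBasis s).ofLp = O := by
  have h := hO.sum_smul_ketbra id
  have h' := hO.spectral_theorem
  rw [Unitary.conjStarAlgAut_apply] at h'
  exact h.trans h'.symm

theorem Matrix.IsHermitian.sum_eigenvalues_sq_smul_ketbra {S : Type} [Fintype S] [DecidableEq S]
    {O : Matrix S S ℂ} (hO : O.IsHermitian) :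
    ∑ s, ((hO.eigenvalues s ^ 2 : ℝ) : ℂ) • ketbra (hO.eigenvectorBasis s).ofLp = O * O := by
  have h := hO.sum_smul_ketbra fun x => x ^ 2
  have h1 := (hO.sum_smul_ketbra id).symm.trans hO.sum_eigenvalues_smul_ketbra
  rw [h]
  refine Eq.trans ?_ (congrArg₂ (· * ·) h1 h1)
  have hU : star (hO.eigenvectorUnitary : Matrix S S ℂ) * hO.eigenvectorUnitary = 1 :=
    Unitary.coe_star_mul_self _
  simp only [mul_assoc]
  rw [← mul_assoc (star _) (hO.eigenvectorUnitary : Matrix S S ℂ), hU, one_mul,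
    ← mul_assoc (diagonal _) (diagonal _), diagonal_mul_diagonal]
  simp [sq]

theorem star_eigenvectorBasis_dotProduct {S : Type} [Fintype S] [DecidableEq S]
    {O : Matrix S S ℂ} (hO : O.IsHermitian) (s : S) :
    star (hO.eigenvectorBasis s).ofLp ⬝ᵥ (hO.eigenvectorBasis s).ofLp = 1 := by
  have h := hO.eigenvectorBasis.orthonormal.1 s
  have h2 := inner_self_eq_norm_sq_to_K (𝕜 := ℂ) (hO.eigenvectorBasis s)
  rw [h, EuclideanSpace.inner_eq_star_dotProduct, dotProduct_comm] at h2
  simpa using h2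

namespace QProgram

variable {S Q : Type} [Fintype S] [DecidableEq S] {R : Q → Type}

/-- Measure the observable `O` and output the eigenvalue that is found. -/
def measureObs {O : Matrix S S ℂ} (hO : O.IsHermitian) : QProgram S R ℝ :=
  .measure (fun j : Fin (Fintype.card S) =>
    ketbra (hO.eigenvectorBasis ((Fintype.equivFin S).symm j)).ofLp) (by
      rw [(Fintype.equivFin S).symm.sum_comp fun s =>
        (ketbra (hO.eigenvectorBasis s).ofLp)ᴴ * ketbra (hO.eigenvectorBasis s).ofLp,
        ← hO.sum_ketbra]
      refine Finset.sum_congr rfl fun s _ => ?_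
      rw [isHermitian_ketbra, ketbra_mul_ketbra (star_eigenvectorBasis_dotProduct hO s)])
    fun j => .output (hO.eigenvalues ((Fintype.equivFin S).symm j))

theorem queries_measureObs {O : Matrix S S ℂ} (hO : O.IsHermitian) :
    (measureObs hO : QProgram S R ℝ).queries ≤ 0 :=
  Finset.sup_le fun _ _ => le_rfl

variable [∀ q, Fintype (R q)] {ans : ∀ q, OracleAction (R q)}

/-- The measurement projects onto single eigenvectors even within a degenerate eigenspace. This does
not affect the law of the output, which depends on the spectral function f(O) alone. -/
theorem expect_measureObs {O : Matrix S S ℂ} (hO : O.IsHermitian) (f : ℝ → ℝ)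
    (ρ : Matrix S S ℂ) :
    (measureObs hO).expect ans f ρ =
      trace ((∑ s, (f (hO.eigenvalues s) : ℂ) • ketbra (hO.eigenvectorBasis s).ofLp) * ρ) := by
  simp only [measureObs, expect]
  rw [(Fintype.equivFin S).symm.sum_comp fun s => (f (hO.eigenvalues s) : ℂ) *
    trace (ketbra (hO.eigenvectorBasis s).ofLp * ρ * (ketbra (hO.eigenvectorBasis s).ofLp)ᴴ),
    Finset.sum_mul, trace_sum]
  refine Finset.sum_congr rfl fun s _ => ?_
  rw [trace_mul_comm, isHermitian_ketbra, ← mul_assoc,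
    ketbra_mul_ketbra (star_eigenvectorBasis_dotProduct hO s), smul_mul, trace_smul, smul_eq_mul]

theorem expect_measureObs_id {O : Matrix S S ℂ} (hO : O.IsHermitian) (ρ : Matrix S S ℂ) :
    (measureObs hO).expect ans id ρ = trace (O * ρ) := by
  rw [expect_measureObs]
  simp only [id, hO.sum_eigenvalues_smul_ketbra]

theorem expect_measureObs_sq {O : Matrix S S ℂ} (hO : O.IsHermitian) (ρ : Matrix S S ℂ) :
    (measureObs hO).expect ans (fun x => x ^ 2) ρ = trace (O * O * ρ) := by
  rw [expect_measureObs, hO.sum_eigenvalues_sq_smul_ketbra]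

end QProgram

/-! ### Gibbs states -/

/-- The exponential is X†X with X the exponential of A/2, which is Hermitian and invertible. -/
theorem posDef_exp {R : Type} [Fintype R] [DecidableEq R] {A : Matrix R R ℂ}
    (hA : A.IsHermitian) : (NormedSpace.exp A).PosDef := by
  set B := (2⁻¹ : ℂ) • A with hB
  have hBh : Bᴴ = B := by
    rw [hB, conjTranspose_smul, hA]; simp
  have hAB : A = B + B := by rw [hB, ← add_smul]; norm_num
  have hexp : NormedSpace.exp A = (NormedSpace.exp B)ᴴ * NormedSpace.exp B := by
    rw [← Matrix.exp_conjTranspose, hBh, ← Matrix.exp_add_of_commute _ _ (Commute.refl B), ← hAB]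
  rw [hexp]
  refine PosDef.conjTranspose_mul_self _ ?_
  exact Matrix.mulVec_injective_of_isUnit (Matrix.isUnit_exp B)

theorem gibbs_posSemidef {R : Type} [Fintype R] [DecidableEq R] [Nonempty R] {A : Matrix R R ℂ}
    (hA : A.IsHermitian) : (gibbs A).PosSemidef :=
  (posDef_exp hA).posSemidef.smul (RCLike.inv_pos_of_pos (posDef_exp hA).trace_pos).le

theorem trace_gibbs {R : Type} [Fintype R] [DecidableEq R] [Nonempty R] {A : Matrix R R ℂ}
    (hA : A.IsHermitian) : trace (gibbs A) = 1 := by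
  rw [gibbs, trace_smul, smul_eq_mul, inv_mul_cancel₀ (posDef_exp hA).trace_pos.ne']

/-! ### The gradient in terms of conditional operators -/

/-- The label projector on the hidden and label registers. -/
def hidProj (h : ℕ) (ℓ : EuclideanSpace ℂ (Fin 2)) : Matrix (Hid h) (Hid h) ℂ :=
  (1 : Matrix (Qubits h) (Qubits h) ℂ) ⊗ₖ ketbra ℓ.ofLp

theorem star_dotProduct_of_norm_eq_one {ι : Type} [Fintype ι] {v : EuclideanSpace ℂ ι}
    (hv : ‖v‖ = 1) : star v.ofLp ⬝ᵥ v.ofLp = 1 := by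
  have h2 := inner_self_eq_norm_sq_to_K (𝕜 := ℂ) v
  rw [hv, EuclideanSpace.inner_eq_star_dotProduct, dotProduct_comm] at h2
  simpa using h2

theorem hidProj_isHermitian (h : ℕ) (ℓ : EuclideanSpace ℂ (Fin 2)) :
    (hidProj h ℓ).IsHermitian := by
  rw [IsHermitian, hidProj, conjTranspose_kronecker, conjTranspose_one, isHermitian_ketbra]

theorem hidProj_mul_self {h : ℕ} {ℓ : EuclideanSpace ℂ (Fin 2)} (hℓ : ‖ℓ‖ = 1) :
    hidProj h ℓ * hidProj h ℓ = hidProj h ℓ := by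
  rw [hidProj, ← mul_kronecker_mul, ketbra_mul_ketbra (star_dotProduct_of_norm_eq_one hℓ), one_mul]

section

variable {n h : ℕ}

theorem condHarmony_isHermitian {A : Matrix (Full n h) (Full n h) ℂ} (hA : A.IsHermitian)
    (v : EuclideanSpace ℂ (Qubits n)) : (condHarmony A v).IsHermitian := by
  ext x y
  simp only [condHarmony, conjTranspose_apply, of_apply, star_sum, star_mul', star_star]
  rw [Finset.sum_comm]
  refine Finset.sum_congr rfl fun a _ => Finset.sum_congr rfl fun b _ => ?_
  rw [← hA.apply (a, x) (b, y)]
  ring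

theorem harmony_isHermitian {D : ℕ} {H : Fin D → Matrix (Full n h) (Full n h) ℂ}
    (hH : ∀ i, (H i).IsHermitian) (ω : Fin D → ℝ) : (harmony H ω).IsHermitian := by
  rw [IsHermitian, harmony, conjTranspose_sum]
  refine Finset.sum_congr rfl fun i _ => ?_
  rw [conjTranspose_smul, hH i]
  simp

/-- The isometry `|v⟩ ⊗ 1`. -/
def dataIsometry (h : ℕ) (v : EuclideanSpace ℂ (Qubits n)) : Matrix (Full n h) (Hid h) ℂ :=
  of fun s y => v s.1 * (1 : Matrix (Hid h) (Hid h) ℂ) s.2 y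

theorem dataIsometry_mul (v : EuclideanSpace ℂ (Qubits n)) (σ : Matrix (Hid h) (Hid h) ℂ)
    (s : Full n h) (y : Hid h) : (dataIsometry h v * σ) s y = v s.1 * σ s.2 y := by
  simp only [Matrix.mul_apply, dataIsometry, of_apply, mul_assoc, ← Finset.mul_sum]
  rw [← Matrix.mul_apply, Matrix.one_mul]

theorem condHarmony_eq (A : Matrix (Full n h) (Full n h) ℂ) (v : EuclideanSpace ℂ (Qubits n)) :
    condHarmony A v = (dataIsometry h v)ᴴ * A * dataIsometry h v := by
  ext x y
  rw [Matrix.mul_assoc, Matrix.mul_apply, Fintype.sum_prod_type]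
  simp only [Matrix.mul_apply, Fintype.sum_prod_type (γ := ℂ) (α₁ := Qubits n) (α₂ := Hid h),
    dataIsometry, condHarmony, of_apply, conjTranspose_apply, Matrix.one_apply, mul_ite, mul_one,
    mul_zero, apply_ite star, star_zero, ite_mul, zero_mul, Finset.sum_ite_eq', Finset.mem_univ,
    if_true, Finset.mul_sum, mul_assoc]
  refine Finset.sum_congr rfl fun a _ => ?_
  rw [Finset.sum_comm]
  simp only [Finset.sum_ite_eq', Finset.mem_univ, if_true]

theorem kronecker_ketbra_eq (v : EuclideanSpace ℂ (Qubits n)) (σ : Matrix (Hid h) (Hid h) ℂ) :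
    ketbra v.ofLp ⊗ₖ σ = dataIsometry h v * σ * (dataIsometry h v)ᴴ := by
  ext s t
  rw [Matrix.mul_apply]
  simp only [dataIsometry_mul]
  simp only [kroneckerMap_apply, ketbra, vecMulVec_apply, dataIsometry, of_apply,
    conjTranspose_apply, Matrix.one_apply, mul_ite, mul_one, mul_zero, apply_ite star, star_zero,
    Finset.sum_ite_eq, Finset.mem_univ, if_true, Pi.star_apply]
  ring

/-- The two operators act on different tensor factors. This intertwining carries the label projector
through the compression to the data state. -/
theorem labelProj_mul_dataIsometry (ℓ : EuclideanSpace ℂ (Fin 2))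
    (v : EuclideanSpace ℂ (Qubits n)) :
    labelProj n h ℓ * dataIsometry h v = dataIsometry h v * hidProj h ℓ := by
  ext s y
  rw [dataIsometry_mul, Matrix.mul_apply, Fintype.sum_prod_type]
  simp only [labelProj, kroneckerMap_apply _ (1 : Matrix (Qubits n) (Qubits n) ℂ), dataIsometry,
    of_apply, Matrix.one_apply, mul_ite, mul_one, mul_zero,
    ite_mul, zero_mul, one_mul, Finset.sum_ite_eq', Finset.mem_univ, if_true]
  rw [Finset.sum_eq_single s.1]
  · rw [if_pos rfl, hidProj, mul_comm]
  · intro a _ ha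
    rw [if_neg ha.symm]
  · simp

theorem dataIsometry_conjTranspose_mul_self {v : EuclideanSpace ℂ (Qubits n)} (hv : ‖v‖ = 1) :
    (dataIsometry h v)ᴴ * dataIsometry h v = 1 := by
  have h1 := star_dotProduct_of_norm_eq_one hv
  ext x y
  simp only [Matrix.mul_apply, Fintype.sum_prod_type, dataIsometry, of_apply,
    conjTranspose_apply, Matrix.one_apply, mul_ite, mul_one, mul_zero, apply_ite star, star_zero,
    ite_mul, zero_mul, Finset.sum_ite_eq', Finset.mem_univ, if_true]
  by_cases hxy : x = y
  · simpa [hxy, dotProduct] using h1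
  · simp [hxy, Ne.symm hxy]

/-- Cyclicity of the trace, with |v⟩⟨v| ⊗ σ written as the conjugate of σ by the isometry |v⟩ ⊗ 1.
-/
theorem trace_mul_kronecker_ketbra (A : Matrix (Full n h) (Full n h) ℂ)
    (v : EuclideanSpace ℂ (Qubits n)) (σ : Matrix (Hid h) (Hid h) ℂ) :
    trace (A * (ketbra v.ofLp ⊗ₖ σ)) = trace (condHarmony A v * σ) := by
  rw [kronecker_ketbra_eq, condHarmony_eq, ← Matrix.mul_assoc, trace_mul_comm]
  simp only [Matrix.mul_assoc]

theorem condHarmony_labelProj_mul (ℓ : EuclideanSpace ℂ (Fin 2))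
    (A : Matrix (Full n h) (Full n h) ℂ) (v : EuclideanSpace ℂ (Qubits n)) :
    condHarmony (labelProj n h ℓ * A) v = hidProj h ℓ * condHarmony A v := by
  have h1 : (labelProj n h ℓ)ᴴ = labelProj n h ℓ := by
    simp only [labelProj, conjTranspose_kronecker, conjTranspose_one]
    rw [isHermitian_ketbra]
  have h2 := congrArg conjTranspose (labelProj_mul_dataIsometry (h := h) ℓ v)
  rw [conjTranspose_mul, conjTranspose_mul, h1, hidProj_isHermitian] at h2
  rw [condHarmony_eq, condHarmony_eq, ← Matrix.mul_assoc, h2]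
  simp only [Matrix.mul_assoc]

theorem condHarmony_mul_labelProj (ℓ : EuclideanSpace ℂ (Fin 2))
    (A : Matrix (Full n h) (Full n h) ℂ) (v : EuclideanSpace ℂ (Qubits n)) :
    condHarmony (A * labelProj n h ℓ) v = condHarmony A v * hidProj h ℓ := by
  rw [condHarmony_eq, condHarmony_eq]
  simp only [Matrix.mul_assoc, labelProj_mul_dataIsometry]

theorem condHarmony_one {v : EuclideanSpace ℂ (Qubits n)} (hv : ‖v‖ = 1) :
    condHarmony (1 : Matrix (Full n h) (Full n h) ℂ) v = 1 := by
  rw [condHarmony_eq, Matrix.mul_one, dataIsometry_conjTranspose_mul_self hv]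

theorem condExp_eq (ℋ A : Matrix (Full n h) (Full n h) ℂ) (v : EuclideanSpace ℂ (Qubits n)) :
    condExp ℋ v A = trace (condHarmony A v * gibbs (condHarmony ℋ v)) := by
  rw [condExp, gibbs, Matrix.mul_smul, trace_smul, smul_eq_mul, ← trace_mul_kronecker_ketbra]
  exact div_eq_inv_mul _ _

/-- Compression to the data state is a bimodule map over the label projectors, so the commutation
survives it. -/
theorem commute_hidProj_condHarmony {ℓ : EuclideanSpace ℂ (Fin 2)}
    {A : Matrix (Full n h) (Full n h) ℂ} (hA : Commute (labelProj n h ℓ) A)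
    (v : EuclideanSpace ℂ (Qubits n)) : Commute (hidProj h ℓ) (condHarmony A v) := by
  rw [Commute, SemiconjBy, ← condHarmony_labelProj_mul, hA.eq, condHarmony_mul_labelProj]

theorem ofReal_re_trace_mul {R : Type} [Fintype R] {A B : Matrix R R ℂ} (hA : A.IsHermitian)
    (hB : B.IsHermitian) : ((trace (A * B)).re : ℂ) = trace (A * B) := by
  refine Complex.conj_eq_iff_re.1 ?_
  rw [starRingEnd_apply, ← trace_conjTranspose, conjTranspose_mul, hA.eq, hB.eq, trace_mul_comm]

/-- The components of the gradient as real numbers. -/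
theorem gradVec_eq {D K : ℕ} {H : Fin D → Matrix (Full n h) (Full n h) ℂ}
    (hH : ∀ i, (H i).IsHermitian) (ω : Fin D → ℝ) {v : Fin K → EuclideanSpace ℂ (Qubits n)}
    (hv : ∀ k, ‖v k‖ = 1) {ℓ : Fin K → EuclideanSpace ℂ (Fin 2)} (hc : ∀ k i, Commute (labelProj n h (ℓ k)) (H i)) :
    ∃ g : Fin D → ℝ, gradVec H ω v ℓ = WithLp.toLp 2 (fun i => (g i : ℂ)) ∧
      ∀ i, (g i : ℂ) = (1 / (K : ℂ)) * ∑ k,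
        (trace (hidProj h (ℓ k) * condHarmony (H i) (v k) *
            gibbs (condHarmony (harmony H ω) (v k))) -
          trace (hidProj h (ℓ k) * gibbs (condHarmony (harmony H ω) (v k))) *
            trace (condHarmony (H i) (v k) * gibbs (condHarmony (harmony H ω) (v k)))) := by
  set τ := fun k => gibbs (condHarmony (harmony H ω) (v k))
  have hτ : ∀ k, (τ k).IsHermitian := fun k =>
    (gibbs_posSemidef (condHarmony_isHermitian (harmony_isHermitian hH ω) (v k))).isHermitian
  -- A product of commuting Hermitian matrices is Hermitian, so its trace against the Gibbs state is
  -- real.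
  have hh : ∀ k i, (hidProj h (ℓ k) * condHarmony (H i) (v k)).IsHermitian := fun k i =>
    by rw [IsHermitian, conjTranspose_mul, hidProj_isHermitian, condHarmony_isHermitian (hH i),
      (commute_hidProj_condHarmony (hc k i) (v k)).eq]
  refine ⟨fun i => (1 / (K : ℝ)) * ∑ k,
    ((trace (hidProj h (ℓ k) * condHarmony (H i) (v k) * τ k)).re -
      (trace (hidProj h (ℓ k) * τ k)).re * (trace (condHarmony (H i) (v k) * τ k)).re), ?_⟩
  have hg : ∀ i, (((1 / (K : ℝ)) * ∑ k,
    ((trace (hidProj h (ℓ k) * condHarmony (H i) (v k) * τ k)).re -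
      (trace (hidProj h (ℓ k) * τ k)).re * (trace (condHarmony (H i) (v k) * τ k)).re) : ℝ) : ℂ) =
      (1 / (K : ℂ)) * ∑ k, (trace (hidProj h (ℓ k) * condHarmony (H i) (v k) * τ k) -
        trace (hidProj h (ℓ k) * τ k) * trace (condHarmony (H i) (v k) * τ k)) := by
    intro i
    push_cast
    congr 1
    refine Finset.sum_congr rfl fun k _ => ?_
    rw [ofReal_re_trace_mul (hh k i) (hτ k), ofReal_re_trace_mul (hidProj_isHermitian h _) (hτ k),
      ofReal_re_trace_mul (condHarmony_isHermitian (hH i) (v k)) (hτ k)]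
  refine ⟨?_, hg⟩
  ext i
  refine Eq.trans ?_ (hg i).symm
  simp only [gradVec]
  congr 1
  refine Finset.sum_congr rfl fun k _ => ?_
  -- The case of the identity matrix: the compression of the label projector itself, for which `v k`
  -- must be a unit vector.
  have h1 := condHarmony_labelProj_mul (ℓ k) (1 : Matrix (Full n h) (Full n h) ℂ) (v k)
  rw [mul_one, condHarmony_one (hv k), mul_one] at h1
  simp only [condExp_eq, condHarmony_labelProj_mul, h1, τ]

end

/-! ### Random choices -/

/-- The uniform mixture of finitely many expectation functionals. -/
def Expectation.average {X : Type} {K : ℕ} (hK : 0 < K) (E : Fin K → Expectation X) :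
    Expectation X where
  toLinearMap := (1 / (K : ℝ)) • ∑ k, (E k).toLinearMap
  nonneg f hf := by
    simp only [LinearMap.smul_apply, LinearMap.sum_apply, smul_eq_mul]
    exact mul_nonneg (by positivity) (Finset.sum_nonneg fun k _ => (E k).nonneg f hf)
  one := by
    have : (K : ℝ) ≠ 0 := by positivity
    simp [LinearMap.sum_apply, (E _).one, this]

theorem Expectation.average_apply {X : Type} {K : ℕ} (hK : 0 < K) (E : Fin K → Expectation X)
    (f : X → ℝ) : average hK E f = (1 / (K : ℝ)) * ∑ k, E k f := by
  simp [average, LinearMap.sum_apply]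

namespace QProgram

variable {S Q : Type} [Fintype S] [DecidableEq S] {R : Q → Type} {α : Type}

/-- Choose `k` uniformly at random. -/
def choose {K : ℕ} (hK : 0 < K) (p : Fin K → QProgram S R α) : QProgram S R α :=
  -- Multiples of the identity as Kraus operators: the outcome is uniform and the state is
  -- untouched.
  .measure (fun _ => ((Real.sqrt K)⁻¹ : ℂ) • (1 : Matrix S S ℂ)) (by
    have h : ((Real.sqrt K)⁻¹ : ℂ) * (Real.sqrt K : ℂ)⁻¹ = (K : ℂ)⁻¹ := by
      rw [← mul_inv, ← Complex.ofReal_mul, Real.mul_self_sqrt (Nat.cast_nonneg K),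
        Complex.ofReal_natCast]
    have hK' : (K : ℂ) ≠ 0 := by exact_mod_cast hK.ne'
    simp [conjTranspose_smul, smul_smul, h, ← Nat.cast_smul_eq_nsmul ℂ, hK']) p

theorem queries_choose_le {K m : ℕ} (hK : 0 < K) {p : Fin K → QProgram S R α}
    (hp : ∀ k, (p k).queries ≤ m) : (choose hK p).queries ≤ m :=
  Finset.sup_le fun k _ => hp k

theorem HasLaw.choose [∀ q, Fintype (R q)] {ans : ∀ q, OracleAction (R q)} {K : ℕ} (hK : 0 < K)
    {p : Fin K → QProgram S R α} {E : Fin K → Expectation α} (hp : ∀ k, HasLaw ans (p k) (E k)) :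
    HasLaw ans (choose hK p) (.average hK E) := fun f ρ => by
  have h : ((Real.sqrt K)⁻¹ : ℂ) * (Real.sqrt K : ℂ)⁻¹ = (K : ℂ)⁻¹ := by
    rw [← mul_inv, ← Complex.ofReal_mul, Real.mul_self_sqrt (Nat.cast_nonneg K),
      Complex.ofReal_natCast]
  simp only [QProgram.choose, expect, hp _ f, conjTranspose_smul, conjTranspose_one,
    Expectation.average_apply, Matrix.smul_mul, Matrix.one_mul, Matrix.mul_smul, Matrix.mul_one,
    smul_smul, trace_smul]
  have h2 : star ((Real.sqrt K : ℂ)⁻¹) = (Real.sqrt K : ℂ)⁻¹ := by simp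
  rw [h2, h, ← Finset.sum_mul]
  push_cast
  simp only [smul_eq_mul]
  ring

end QProgram

/-! ### Estimating the gradient from copies of the Gibbs states -/

theorem blockOp_const_mulVec {S R T : Type} [Fintype S] [Fintype R] [Fintype T] [DecidableEq T]
    (e : S ≃ R × T) (U : Matrix R R ℂ) {φ : S → ℂ} {x : R → ℂ} {y : T → ℂ}
    (hφ : ∀ r t, φ (e.symm (r, t)) = x r * y t) (s : S) :
    (blockOp e (fun _ => U) *ᵥ φ) s = (U *ᵥ x) (e s).1 * y (e s).2 := by
  rw [blockOp_mulVec, mulVec, dotProduct, Finset.sum_mul]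
  exact Finset.sum_congr rfl fun r _ => by rw [hφ, mul_assoc]

theorem ket_prod {R T : Type} [DecidableEq R] [DecidableEq T] (r r' : R) (t t' : T) :
    ket (r, t) (r', t') = ket r r' * ket t t' := by
  simp only [ket, Pi.single_apply, Prod.mk.injEq]
  split_ifs <;> simp_all

section Sample

variable {n h K : ℕ}

/-- The data register together with the label qubit, as a tensor factor. -/
def dataLabelEquiv (n h : ℕ) : Full n h ≃ (Qubits n × Fin 2) × Qubits h where
  toFun s := ((s.1, s.2.2), s.2.1)
  invFun t := (t.1.1, (t.2, t.1.2))
  left_inv _ := rfl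
  right_inv _ := rfl

/-- Prepare `|v_k⟩⟨v_k| ⊗ τ_k`. -/
def prepState {α : Type} (k : Fin K) (next : QProgram (Full n h) (SampleQuery.reg n h (K := K)) α) :
    QProgram (Full n h) (SampleQuery.reg n h (K := K)) α :=
  .prep (ket 0) (star_ket_dotProduct_ket 0)
    (.query (.F k) (Qubits h) (dataLabelEquiv n h)
      (.query (.G k) (Qubits n) (Equiv.prodComm _ _) next))

/-- Continue with `next` if the label is found to be `ℓ_k`, and output `o` otherwise. -/
def testLabel {α : Type} (k : Fin K) (next : QProgram (Full n h) (SampleQuery.reg n h (K := K)) α)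
    (o : α) : QProgram (Full n h) (SampleQuery.reg n h (K := K)) α :=
  -- Conjugating |0⟩⟨0| by F(k) gives the projector onto |v_k⟩|ℓ_k⟩, which acts as the label
  -- projector once the data register holds |v_k⟩.
  .query (.Finv k) (Qubits h) (dataLabelEquiv n h)
    (.measure ![blockOp (dataLabelEquiv n h) fun _ => ketbra (ket 0),
        blockOp (dataLabelEquiv n h) fun _ => 1 - ketbra (ket 0)] (by
        have h1 : ketbra (ket (0 : Qubits n × Fin 2)) * ketbra (ket 0) = ketbra (ket 0) :=
          ketbra_mul_ketbra (star_ket_dotProduct_ket 0)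
        have h2 : (1 - ketbra (ket (0 : Qubits n × Fin 2))) * (1 - ketbra (ket 0))
            = 1 - ketbra (ket 0) := by
          rw [mul_sub, sub_mul, sub_mul, h1]; simp
        have h3 : (1 - ketbra (ket (0 : Qubits n × Fin 2)))ᴴ = 1 - ketbra (ket 0) := by
          rw [conjTranspose_sub, conjTranspose_one, isHermitian_ketbra]
        rw [Fin.sum_univ_two]
        simp only [cons_val_zero, cons_val_one, blockOp_conjTranspose, blockOp_mul, h2, h3]
        rw [isHermitian_ketbra, h1]
        ext s t
        rw [Matrix.add_apply, blockOp_apply, blockOp_apply,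
          ← blockOp_one (dataLabelEquiv n h), blockOp_apply]
        split_ifs <;> simp)
      ![.query (.F k) (Qubits h) (dataLabelEquiv n h) next, .output o])

theorem queries_prepState_le {α : Type} {m : ℕ} (k : Fin K)
    {next : QProgram (Full n h) (SampleQuery.reg n h (K := K)) α} (hm : next.queries ≤ m) :
    (prepState k next).queries ≤ m + 2 :=
  (QProgram.queries_prep_le _ _ _).trans (by simpa [QProgram.queries] using hm)

theorem queries_testLabel_le {α : Type} {m : ℕ} (k : Fin K)
    {next : QProgram (Full n h) (SampleQuery.reg n h (K := K)) α} (hm : next.queries ≤ m) (o : α) :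
    (testLabel k next o).queries ≤ m + 2 := by
  refine Nat.succ_le_succ (Finset.sup_le fun j _ => ?_)
  fin_cases j
  · simpa [QProgram.queries] using hm
  · simp [QProgram.queries]

variable {v : Fin K → EuclideanSpace ℂ (Qubits n)} {ℓ : Fin K → EuclideanSpace ℂ (Fin 2)}
  {F : Fin K → Matrix (Qubits n × Fin 2) (Qubits n × Fin 2) ℂ}
  {τ : Fin K → Matrix (Hid h) (Hid h) ℂ}

theorem isChannel_sampleOracle (hF : IsDataOracle v ℓ F) (hτ : ∀ k, (τ k).PosSemidef)
    (hτ' : ∀ k, trace (τ k) = 1) (q : SampleQuery K) : (sampleOracle F τ q).IsChannel := by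
  cases q with
  | F k => exact ⟨inferInstance, (Matrix.mem_unitaryGroup_iff'.1 (hF k).1)⟩
  | Finv k =>
    refine ⟨inferInstance, ?_⟩
    rw [conjTranspose_conjTranspose]
    exact Matrix.mem_unitaryGroup_iff.1 (hF k).1
  | G k => exact ⟨hτ k, hτ' k⟩

/-- F(k) produces |v_k⟩|ℓ_k⟩; the preparation of τ_k then overwrites the hidden and label qubits,
whose partial trace is 1 because ℓ_k is a unit vector and the hidden register is in a basis state.
-/
theorem expect_prepState {α : Type} (hF : IsDataOracle v ℓ F) (hℓ : ∀ k, ‖ℓ k‖ = 1) (k : Fin K)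
    (next : QProgram (Full n h) (SampleQuery.reg n h (K := K)) α) (f : α → ℝ)
    (ρ : Matrix (Full n h) (Full n h) ℂ) :
    (prepState k next).expect (sampleOracle F τ) f ρ =
      next.expect (sampleOracle F τ) f (ketbra (v k).ofLp ⊗ₖ τ k) * trace ρ := by
  rw [prepState, QProgram.expect_prep]
  congr 1
  simp only [QProgram.expect, sampleOracle, OracleAction.apply]
  rw [kronecker_one_submatrix, mul_ketbra_mul]
  congr 1
  have h1 : blockOp (dataLabelEquiv n h) (fun _ => F k) *ᵥ ket 0 =
      fun s => v k s.1 * ℓ k s.2.2 * ket 0 s.2.1 := by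
    ext s
    rw [blockOp_const_mulVec (dataLabelEquiv n h) (F k) (x := ket 0) (y := ket 0), (hF k).2]
    · rfl
    · intro r t
      change ket ((0 : Qubits n), ((0 : Qubits h), (0 : Fin 2))) (r.1, (t, r.2)) =
        ket ((0 : Qubits n), (0 : Fin 2)) (r.1, r.2) * ket 0 t
      rw [ket_prod, ket_prod, ket_prod]
      ring
  have h2 : ∑ z, ℓ k z * star (ℓ k z) = 1 := by
    simpa [dotProduct, mul_comm] using star_dotProduct_of_norm_eq_one (hℓ k)
  have h3 : ∑ x : Qubits h, ket 0 x * star (ket 0 x : ℂ) = 1 := by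
    simpa [dotProduct, mul_comm] using star_ket_dotProduct_ket (0 : Qubits h)
  rw [h1]
  ext s t
  simp only [submatrix_apply, kroneckerMap_apply, of_apply, ketbra, vecMulVec_apply, Pi.star_apply,
    star_mul', Equiv.prodComm_apply, Prod.fst_swap, Prod.snd_swap, Equiv.prodComm_symm,
    Prod.swap_prod_mk]
  rw [Fintype.sum_prod_type]
  have h4 : ∀ (x : Qubits h) (z : Fin 2), v k s.1 * ℓ k z * ket 0 x *
      (star (v k t.1) * star (ℓ k z) * star (ket 0 x)) =
      v k s.1 * star (v k t.1) * (ket 0 x * star (ket 0 x)) * (ℓ k z * star (ℓ k z)) :=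
    fun x z => by ring
  simp only [h4, ← Finset.mul_sum, h2, h3, mul_one]
  ring

/-- The success branch conjugates the state by |v_k⟩⟨v_k| ⊗ P, whose data part is absorbed by the
state. The failure branch contributes nothing because `f` vanishes at its output. -/
theorem expect_testLabel {α : Type} (hF : IsDataOracle v ℓ F) (hv : ∀ k, ‖v k‖ = 1) (k : Fin K)
    (next : QProgram (Full n h) (SampleQuery.reg n h (K := K)) α) {f : α → ℝ} {o : α}
    (ho : f o = 0) (σ : Matrix (Hid h) (Hid h) ℂ) :
    (testLabel k next o).expect (sampleOracle F τ) f (ketbra (v k).ofLp ⊗ₖ σ) =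
      next.expect (sampleOracle F τ) f
        (ketbra (v k).ofLp ⊗ₖ (hidProj h (ℓ k) * σ * hidProj h (ℓ k))) := by
  simp only [testLabel, QProgram.expect, Fin.sum_univ_two, cons_val_zero, cons_val_one, ho]
  simp only [sampleOracle, OracleAction.apply, kronecker_one_submatrix]
  have h1 : blockOp (dataLabelEquiv n h) (fun _ => F k) *
      (blockOp (dataLabelEquiv n h) (fun _ => ketbra (ket 0)) *
        blockOp (dataLabelEquiv n h) fun _ => (F k)ᴴ) =
      ketbra (v k).ofLp ⊗ₖ hidProj h (ℓ k) := by
    rw [blockOp_mul, blockOp_mul]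
    simp only [← mul_assoc, mul_ketbra_mul, (hF k).2]
    ext s t
    rw [blockOp_apply]
    simp only [dataLabelEquiv, Equiv.coe_fn_mk, ketbra, vecMulVec_apply, Pi.star_apply, star_mul',
      kroneckerMap_apply, hidProj, Matrix.one_apply]
    split_ifs <;> ring
  have h2 : ketbra (v k).ofLp * ketbra (v k).ofLp = ketbra (v k).ofLp :=
    ketbra_mul_ketbra (star_dotProduct_of_norm_eq_one (hv k))
  have h3 : (ketbra (v k).ofLp ⊗ₖ hidProj h (ℓ k))ᴴ = ketbra (v k).ofLp ⊗ₖ hidProj h (ℓ k) := by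
    rw [conjTranspose_kronecker, isHermitian_ketbra, hidProj_isHermitian]
  rw [Complex.ofReal_zero, zero_mul, add_zero]
  congr 1
  have h4 : ketbra (v k).ofLp ⊗ₖ (hidProj h (ℓ k) * σ * hidProj h (ℓ k)) =
      (ketbra (v k).ofLp ⊗ₖ hidProj h (ℓ k)) * (ketbra (v k).ofLp ⊗ₖ σ) *
        (ketbra (v k).ofLp ⊗ₖ hidProj h (ℓ k))ᴴ := by
    rw [h3, ← mul_kronecker_mul, ← mul_kronecker_mul, h2, h2]
  rw [h4, ← h1]
  simp only [conjTranspose_mul, mul_assoc]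

/-- A sample of `P_ℓ 𝒪` in the state `|v_k⟩⟨v_k| ⊗ τ_k`. -/
def sampleLabelObs {O : Matrix (Full n h) (Full n h) ℂ} (hO : O.IsHermitian) (k : Fin K) :
    QProgram (Full n h) (SampleQuery.reg n h (K := K)) ℝ :=
  prepState k (testLabel k (.measureObs hO) 0)

/-- A sample of `P_ℓ` in the state `|v_k⟩⟨v_k| ⊗ τ_k`. -/
def sampleLabel (n h : ℕ) (k : Fin K) :
    QProgram (Full n h) (SampleQuery.reg n h (K := K)) Bool :=
  prepState k (testLabel k (.output true) false)

/-- A sample of `𝒪` in the state `|v_k⟩⟨v_k| ⊗ τ_k`. -/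
def sampleObs {O : Matrix (Full n h) (Full n h) ℂ} (hO : O.IsHermitian) (k : Fin K) :
    QProgram (Full n h) (SampleQuery.reg n h (K := K)) ℝ :=
  prepState k (.measureObs hO)

/-- A sample of `P_ℓ 𝒪` minus the product of independent samples of `P_ℓ` and `𝒪`, for a random
training example. -/
def sampleCov (hK : 0 < K) {O : Matrix (Full n h) (Full n h) ℂ} (hO : O.IsHermitian) :
    QProgram (Full n h) (SampleQuery.reg n h (K := K)) ℝ :=
  .choose hK fun k => (sampleLabelObs hO k).bind fun x => (sampleLabel n h k).bind fun b =>
    (sampleObs hO k).bind fun y => .output (x - (if b then 1 else 0) * y)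

theorem queries_sampleCov_le (hK : 0 < K) {O : Matrix (Full n h) (Full n h) ℂ}
    (hO : O.IsHermitian) : (sampleCov hK hO).queries ≤ 10 := by
  refine QProgram.queries_choose_le hK fun k => ?_
  have h1 : (sampleLabelObs hO k).queries ≤ 4 :=
    queries_prepState_le k (queries_testLabel_le k (QProgram.queries_measureObs hO) 0)
  have h2 : (sampleLabel n h k).queries ≤ 4 :=
    queries_prepState_le k (queries_testLabel_le k (le_refl 0) false)
  have h3 : (sampleObs hO k).queries ≤ 2 :=
    queries_prepState_le k (QProgram.queries_measureObs hO)
  exact QProgram.queries_bind_le h1 fun x => QProgram.queries_bind_le h2 fun b =>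
    QProgram.queries_bind_le (n := 0) h3 fun y => le_refl 0

/-- Unbiasedness is independence of the three samples. Measuring ℋ_i after a successful label test
has mean Tr(P C P τ), which equals Tr(P C τ) by commutation. Outputs have second moments at most 1
because the observable squares to 1. -/
theorem exists_hasLaw_sampleCov (hK : 0 < K) {O : Matrix (Full n h) (Full n h) ℂ}
    (hO : O.IsHermitian) (hO' : O * O = 1) (hF : IsDataOracle v ℓ F) (hv : ∀ k, ‖v k‖ = 1)
    (hℓ : ∀ k, ‖ℓ k‖ = 1) (hc : ∀ k, Commute (labelProj n h (ℓ k)) O)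
    (hτ : ∀ k, (τ k).PosSemidef) (hτ' : ∀ k, trace (τ k) = 1) {g : ℝ}
    (hg : (g : ℂ) = (1 / (K : ℂ)) * ∑ k, (trace (hidProj h (ℓ k) * condHarmony O (v k) * τ k) -
      trace (hidProj h (ℓ k) * τ k) * trace (condHarmony O (v k) * τ k))) :
    ∃ E, (sampleCov hK hO).HasLaw (sampleOracle F τ) E ∧ E id = g ∧ E (fun x => x ^ 2) ≤ 4 := by
  have hans := isChannel_sampleOracle hF hτ hτ'
  have hk : ∀ k, ∃ E, QProgram.HasLaw (sampleOracle F τ)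
      ((sampleLabelObs hO k).bind fun x => (sampleLabel n h k).bind fun b =>
        (sampleObs hO k).bind fun y => .output (x - (if b then 1 else 0) * y)) E ∧
      (E id : ℂ) = trace (hidProj h (ℓ k) * condHarmony O (v k) * τ k) -
        trace (hidProj h (ℓ k) * τ k) * trace (condHarmony O (v k) * τ k) ∧
      E (fun x => x ^ 2) ≤ 4 := by
    intro k
    have htr : trace (ketbra (ket (0 : Full n h))) = 1 := by
      rw [trace_ketbra, star_ket_dotProduct_ket]
    have hp := hidProj_mul_self (h := h) (hℓ k)
    have hcomm := commute_hidProj_condHarmony (hc k) (v k)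
    have htr1 : ∀ σ : Matrix (Hid h) (Hid h) ℂ,
        trace (O * O * (ketbra (v k).ofLp ⊗ₖ σ)) = trace σ := fun σ => by
      rw [hO', trace_mul_kronecker_ketbra, condHarmony_one (hv k), one_mul]
    have htrp : trace (hidProj h (ℓ k) * τ k * hidProj h (ℓ k)) = trace (hidProj h (ℓ k) * τ k) := by
      rw [trace_mul_comm, ← mul_assoc, hp]
    -- Only the existence of the laws is taken from here; their moments are computed below on the
    -- initial state |0⟩⟨0|, which has trace 1.
    obtain ⟨E1, hE1, hf1⟩ := QProgram.exists_hasLaw_prep (ans := sampleOracle F τ) hans (ket 0)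
      (star_ket_dotProduct_ket 0) (.query (.F k) (Qubits h) (dataLabelEquiv n h)
      (.query (.G k) (Qubits n) (Equiv.prodComm _ _) (testLabel k (.measureObs hO) 0)))
    obtain ⟨E2, hE2, hf2⟩ := QProgram.exists_hasLaw_prep (ans := sampleOracle F τ) hans (ket 0)
      (star_ket_dotProduct_ket 0) (.query (.F k) (Qubits h) (dataLabelEquiv n h)
      (.query (.G k) (Qubits n) (Equiv.prodComm _ _) (testLabel k (.output true) false)))
    obtain ⟨E3, hE3, hf3⟩ := QProgram.exists_hasLaw_prep (ans := sampleOracle F τ) hans (ket 0)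
      (star_ket_dotProduct_ket 0) (.query (.F k) (Qubits h) (dataLabelEquiv n h)
      (.query (.G k) (Qubits n) (Equiv.prodComm _ _) (.measureObs hO)))
    clear hf1 hf2 hf3
    change QProgram.HasLaw _ (sampleLabelObs hO k) E1 at hE1
    change QProgram.HasLaw _ (sampleLabel n h k) E2 at hE2
    change QProgram.HasLaw _ (sampleObs hO k) E3 at hE3
    have v1 : (E1 id : ℂ) = trace (hidProj h (ℓ k) * condHarmony O (v k) * τ k) := by
      have := hE1 id (ketbra (ket 0))
      rw [sampleLabelObs, expect_prepState hF hℓ, expect_testLabel hF hv _ _ (by simp),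
        QProgram.expect_measureObs_id, trace_mul_kronecker_ketbra, htr, mul_one, mul_one] at this
      rw [← this, ← mul_assoc, trace_mul_comm, ← mul_assoc, ← mul_assoc, hcomm.eq,
        mul_assoc (condHarmony O (v k)), hp]
    have v2 : (E1 (fun x => x ^ 2) : ℂ) = trace (hidProj h (ℓ k) * τ k) := by
      have := hE1 (fun x => x ^ 2) (ketbra (ket 0))
      rw [sampleLabelObs, expect_prepState hF hℓ, expect_testLabel hF hv _ _ (by simp),
        QProgram.expect_measureObs_sq, htr1, htrp, htr, mul_one, mul_one] at this
      exact this.symm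
    have v3 : (E2 (fun b => if b then 1 else 0) : ℂ) = trace (hidProj h (ℓ k) * τ k) := by
      have := hE2 (fun b => if b then 1 else 0) (ketbra (ket 0))
      rw [sampleLabel, expect_prepState hF hℓ, expect_testLabel hF hv _ _ (by simp),
        htr, mul_one, mul_one] at this
      rw [← this]
      simp only [QProgram.expect, trace_kronecker, trace_ketbra,
        star_dotProduct_of_norm_eq_one (hv k), htrp]
      simp
    have v4 : (E3 id : ℂ) = trace (condHarmony O (v k) * τ k) := by
      have := hE3 id (ketbra (ket 0))
      rw [sampleObs, expect_prepState hF hℓ, QProgram.expect_measureObs_id,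
        trace_mul_kronecker_ketbra, htr, mul_one, mul_one] at this
      exact this.symm
    have v5 : E3 (fun x => x ^ 2) = 1 := by
      have := hE3 (fun x => x ^ 2) (ketbra (ket 0))
      rw [sampleObs, expect_prepState hF hℓ, QProgram.expect_measureObs_sq, htr1, htr, mul_one,
        mul_one, hτ'] at this
      exact_mod_cast this.symm
    have v6 : E2 (fun b => if b then 1 else 0) ≤ 1 := by
      refine (E2.mono (g := fun _ => 1) fun b => ?_).trans (E2.map_const 1).le
      split_ifs <;> norm_num
    have v7 : E1 (fun x => x ^ 2) ≤ 1 := by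
      have : E1 (fun x => x ^ 2) = E2 (fun b => if b then 1 else 0) := by
        exact_mod_cast v2.trans v3.symm
      rw [this]
      exact v6
    refine ⟨_, hE1.bind fun x => hE2.bind fun b => hE3.bind fun y => QProgram.hasLaw_output _,
      ?_, ?_⟩
    · rw [← v1, ← v3, ← v4, ← Complex.ofReal_mul, ← Complex.ofReal_sub, Complex.ofReal_inj]
      simp only [Expectation.bind_apply, Expectation.pure_apply, id]
      have h1 : ∀ (x : ℝ) (b : Bool), E3 (fun y => x - (if b then 1 else 0) * y) =
          x + (-E3 id) * (if b then 1 else 0) := fun x b => by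
        have := E3.map_quadratic 0 (-(if b then 1 else 0)) x
        rw [show (fun y : ℝ => x - (if b then 1 else 0) * y) =
          fun y => 0 * y ^ 2 + -(if b then 1 else 0) * y + x by ext; ring, this]
        ring
      have h2 : ∀ x : ℝ, E2 (fun b => x + (-E3 id) * (if b then 1 else 0)) =
          x + (-E3 id) * E2 (fun b => if b then 1 else 0) := fun x => by
        rw [E2.map_add' (fun _ => x), E2.map_const, E2.map_const_mul]
      simp only [h1, h2]
      rw [E1.map_add' (fun x => x), E1.map_const]
      change E1 id + _ = E1 id - _ * E3 id
      ring
    · simp only [Expectation.bind_apply, Expectation.pure_apply]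
      -- From (x - by)² ≤ 2x² + 2y² for b in {0, 1}, together with E3 y² = 1.
      have h1 : ∀ (x : ℝ) (b : Bool), E3 (fun y => (x - (if b then 1 else 0) * y) ^ 2) ≤
          2 * x ^ 2 + 2 := fun x b => by
        have := E3.map_quadratic 2 0 (2 * x ^ 2)
        rw [v5] at this
        refine (E3.mono fun y => ?_).trans (this.trans (by ring)).le
        split_ifs
        · nlinarith [sq_nonneg (x + y)]
        · nlinarith [sq_nonneg x, sq_nonneg y]
      have h2 : ∀ x : ℝ, E2 (fun b => E3 (fun y => (x - (if b then 1 else 0) * y) ^ 2)) ≤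
          2 * x ^ 2 + 2 := fun x =>
        (E2.mono fun b => h1 x b).trans (E2.map_const _).le
      have h3 := E1.map_quadratic 2 0 2
      calc _ ≤ _ := E1.mono h2
        _ = E1 (fun x => 2 * x ^ 2 + 0 * x + 2) := by simp
        _ ≤ 4 := by rw [h3]; linarith
  choose E hE h1 h2 using hk
  refine ⟨_, QProgram.HasLaw.choose hK hE, ?_, ?_⟩
  · rw [← Complex.ofReal_inj, hg, Expectation.average_apply]
    push_cast
    simp only [h1]
  · rw [Expectation.average_apply, one_div_mul_eq_div, div_le_iff₀ (by positivity)]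
    refine (Finset.sum_le_sum fun k _ => h2 k).trans ?_
    simp [mul_comm]

end Sample

/-- The gradient can be approximated from copies of the Gibbs states. -/
theorem exists_sampleAlgorithm {D n h K : ℕ} (hK : 0 < K) {ε : ℝ} (hε : 0 < ε)
    (H : Fin D → Matrix (Full n h) (Full n h) ℂ) (hH : ∀ i, (H i).IsHermitian)
    (hH' : ∀ i, H i ∈ Matrix.unitaryGroup (Full n h) ℂ) :
    ∃ 𝒜 : QueryAlgorithm (SampleQuery.reg n h (K := K)) (EuclideanSpace ℝ (Fin D)),
      (𝒜.queries : ℝ) ≤ 240 * ((D : ℝ) ^ 2 / ε ^ 2) ∧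
      ∀ (ω : Fin D → ℝ) (v : Fin K → EuclideanSpace ℂ (Qubits n))
        (ℓ : Fin K → EuclideanSpace ℂ (Fin 2)),
        (∀ k, ‖v k‖ = 1) → (∀ k, ‖ℓ k‖ = 1) →
        (∀ k i, Commute (labelProj n h (ℓ k)) (H i)) →
        ∀ F : Fin K → Matrix (Qubits n × Fin 2) (Qubits n × Fin 2) ℂ, IsDataOracle v ℓ F →
          2 / 3 ≤ 𝒜.prob (sampleOracle F fun k => gibbs (condHarmony (harmony H ω) (v k)))
            (approximations (gradVec H ω v ℓ) ε) := by
  have hHH : ∀ i, H i * H i = 1 := fun i => by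
    have := Matrix.mem_unitaryGroup_iff.1 (hH' i)
    rwa [star_eq_conjTranspose, hH i] at this
  -- Even one sample for each component could exceed the budget D²/ε² here. But each component has
  -- square at most 4, so the zero vector has squared error at most 4D ≤ ε²/3.
  by_cases hbig : 12 * (D : ℝ) ≤ ε ^ 2
  · obtain ⟨𝒜, hq, h𝒜⟩ := exists_queryAlgorithm (0 : Full n h)
      (fun _ : Fin D => (.output 0 : QProgram (Full n h) (SampleQuery.reg n h (K := K)) ℝ))
      (m := 0) (fun _ => le_refl 0) hε
    refine ⟨𝒜, ?_, ?_⟩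
    · have : 𝒜.queries = 0 := by simpa using hq
      rw [this, Nat.cast_zero]
      positivity
    intro ω v ℓ hv hℓ hc F hF
    obtain ⟨g, hg, hgi⟩ := gradVec_eq hH ω hv hc
    rw [hg]
    refine h𝒜 _ _ g (fun i => QProgram.hasLaw_output 0) ?_
    have : ∀ i, g i ^ 2 ≤ 4 := fun i => by
      obtain ⟨E, -, h1, h2⟩ := exists_hasLaw_sampleCov hK (hH i) (hHH i) hF hv hℓ
        (fun k => hc k i) (fun k => gibbs_posSemidef
          (condHarmony_isHermitian (harmony_isHermitian hH ω) (v k)))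
        (fun k => trace_gibbs (condHarmony_isHermitian (harmony_isHermitian hH ω) (v k))) (hgi i)
      rw [← h1]
      exact E.sq_map_id_le.trans h2
    calc _ ≤ ∑ _i : Fin D, (4 : ℝ) := Finset.sum_le_sum fun i _ => by simpa using this i
      _ ≤ ε ^ 2 / 3 := by simp; linarith
  · push Not at hbig
    have hD : (0 : ℝ) < D := by nlinarith [sq_nonneg ε]
    -- D variances of at most 4/N each must add up to at most ε²/3. Rounding up at most doubles a
    -- number exceeding 1, whence 24D/ε² runs of 10 queries for each of D components, and the
    -- constant 240.
    set N := ⌈12 * D / ε ^ 2⌉₊ with hN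
    have hN1 : 12 * D / ε ^ 2 ≤ N := Nat.le_ceil _
    have hpos : 1 < 12 * D / ε ^ 2 := by rwa [one_lt_div (by positivity)]
    have hN0 : 0 < N := Nat.ceil_pos.2 (by linarith)
    have hN2 : (N : ℝ) ≤ 24 * D / ε ^ 2 := by
      have := Nat.ceil_lt_add_one (show 0 ≤ 12 * D / ε ^ 2 by linarith)
      have h24 : 24 * D / ε ^ 2 = 12 * D / ε ^ 2 + 12 * D / ε ^ 2 := by ring
      linarith
    obtain ⟨𝒜, hq, h𝒜⟩ := exists_queryAlgorithm (0 : Full n h)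
      (fun i => QProgram.meanRuns (sampleCov hK (hH i)) N)
      (fun i => QProgram.queries_meanRuns_le (queries_sampleCov_le hK (hH i)) N) hε
    refine ⟨𝒜, ?_, ?_⟩
    · have : (𝒜.queries : ℝ) ≤ D * (N * 10) := by exact_mod_cast hq
      calc (𝒜.queries : ℝ) ≤ D * (N * 10) := this
        _ ≤ D * ((24 * D / ε ^ 2) * 10) := by gcongr
        _ = 240 * ((D : ℝ) ^ 2 / ε ^ 2) := by ring
    intro ω v ℓ hv hℓ hc F hF
    obtain ⟨g, hg, hgi⟩ := gradVec_eq hH ω hv hc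
    rw [hg]
    have : ∀ i, ∃ E, (QProgram.meanRuns (sampleCov hK (hH i)) N).HasLaw
        (sampleOracle F fun k => gibbs (condHarmony (harmony H ω) (v k))) E ∧
        E (fun x => (x - g i) ^ 2) ≤ 4 / N := fun i => by
      obtain ⟨E, h0, h1, h2⟩ := exists_hasLaw_sampleCov hK (hH i) (hHH i) hF hv hℓ
        (fun k => hc k i) (fun k => gibbs_posSemidef
          (condHarmony_isHermitian (harmony_isHermitian hH ω) (v k)))
        (fun k => trace_gibbs (condHarmony_isHermitian (harmony_isHermitian hH ω) (v k))) (hgi i)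
      obtain ⟨E', h3, h4⟩ := QProgram.exists_hasLaw_meanRuns h0 hN0
      rw [h1] at h4
      refine ⟨E', h3, h4.le.trans ?_⟩
      gcongr
      rw [E.map_sub_sq, h1]
      nlinarith [sq_nonneg (g i)]
    choose E hE hV using this
    refine h𝒜 _ E g hE ((Finset.sum_le_sum fun i _ => hV i).trans ?_)
    rw [Finset.sum_const, Finset.card_univ, Fintype.card_fin, nsmul_eq_mul]
    rw [div_le_iff₀ (by positivity)] at hN1
    rw [← mul_div_assoc, div_le_iff₀ (by positivity)]
    linarith

/-! ### Program transformers -/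

namespace QProgram

variable {S Q : Type} [Fintype S] [DecidableEq S] {R : Q → Type} {α : Type}

/-- Apply the unitary `U`, then continue with `p`. -/
def gate (U : Matrix S S ℂ) (hU : Uᴴ * U = 1) (p : QProgram S R α) : QProgram S R α :=
  .measure (fun _ : Fin 1 => U) (by simpa using hU) fun _ => p

theorem queries_gate_le (U : Matrix S S ℂ) (hU : Uᴴ * U = 1) (p : QProgram S R α) :
    (gate U hU p).queries ≤ p.queries :=
  Finset.sup_le fun _ _ => le_rfl

variable [∀ q, Fintype (R q)]

/-- Prefixing a program by `t` amounts to applying `A` to the initial state. -/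
def Implements (ans : ∀ q, OracleAction (R q)) (t : QProgram S R α → QProgram S R α)
    (A : Matrix S S ℂ) : Prop :=
  ∀ p f ρ, (t p).expect ans f ρ = p.expect ans f (A * ρ * Aᴴ)

variable {ans : ∀ q, OracleAction (R q)}

theorem implements_gate (U : Matrix S S ℂ) (hU : Uᴴ * U = 1) :
    Implements ans (gate U hU : QProgram S R α → QProgram S R α) U := fun p f ρ => by
  simp [gate, expect]

theorem implements_query {q : Q} {V : Matrix (R q) (R q) ℂ} (hq : ans q = .gate V) (T : Type)
    [Fintype T] [DecidableEq T] (e : S ≃ R q × T) :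
    Implements ans (query q T e : QProgram S R α → QProgram S R α) (blockOp e fun _ => V) :=
  fun p f ρ => by
    simp [expect, hq, OracleAction.apply, kronecker_one_submatrix]

/-- The prefix that runs first is the rightmost factor. -/
theorem Implements.comp {t t' : QProgram S R α → QProgram S R α} {A A' : Matrix S S ℂ}
    (h : Implements ans t A) (h' : Implements ans t' A') :
    Implements ans (fun p => t (t' p)) (A' * A) := fun p f ρ => by
  rw [h, h', conjTranspose_mul]
  simp only [mul_assoc]

end QProgram

/-! ### Amplitude estimation -/

section Amplitude

variable {S : Type} [DecidableEq S]

/-- The unnormalized weight of the `m`-th power in the probe state. -/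
def probeWeight (M m : ℕ) : ℝ := m * (M - m)

theorem sum_probeWeight_sq (M : ℕ) :
    ∑ m ∈ Finset.range (M + 1), probeWeight M m ^ 2 = M * ((M : ℝ) ^ 4 - 1) / 30 := by
  -- The number of terms is separated from the parameter M of the weights so that induction applies.
  have h : ∀ n : ℕ, ∑ m ∈ Finset.range n, probeWeight M m ^ 2 =
      (M : ℝ) ^ 2 * (n * (n - 1) * (2 * n - 1) / 6) - 2 * M * ((n * (n - 1)) ^ 2 / 4) +
        n * (n - 1) * (2 * n - 1) * (3 * n ^ 2 - 3 * n - 1) / 30 := by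
    intro n
    induction n with
    | zero => simp
    | succ n ih =>
      rw [Finset.sum_range_succ, ih, probeWeight]
      push_cast
      ring
  rw [h]
  push_cast
  ring

/-- Half the adjacency matrix of the path with vertices `0, …, M`. -/
def pathMatrix (M : ℕ) : Matrix (Fin (M + 1)) (Fin (M + 1)) ℂ :=
  of fun m m' => (if (m' : ℕ) = m + 1 then 1 / 2 else 0) + (if (m' : ℕ) + 1 = m then 1 / 2 else 0)

theorem sum_pathMatrix_mul (M : ℕ) (y : ℕ → ℂ) (m : Fin (M + 1)) :
    ∑ m', pathMatrix M m m' * y m' =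
      1 / 2 * ((if (m : ℕ) < M then y (m + 1) else 0) + if 0 < (m : ℕ) then y (m - 1) else 0) := by
  have h1 : ∀ m' : Fin (M + 1), pathMatrix M m m' * y m' =
      (fun j : ℕ => (if j = m + 1 then 1 / 2 * y j else 0) +
        if j + 1 = m then 1 / 2 * y j else 0) m' := fun m' => by
    simp only [pathMatrix, of_apply]
    split_ifs <;> ring
  simp only [h1]
  rw [Fin.sum_univ_eq_sum_range (fun j : ℕ => (if j = m + 1 then 1 / 2 * y j else 0) +
        if j + 1 = m then 1 / 2 * y j else 0), Finset.sum_add_distrib, mul_add]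
  congr 1
  · rw [Finset.sum_ite_eq']
    simp
  · obtain ⟨m, hm⟩ := m
    cases m with
    | zero => simp
    | succ k =>
      simp only [add_left_inj, Finset.sum_ite_eq', Finset.mem_range]
      rw [if_pos (by omega), if_pos (by omega)]
      simp

/-- The observable `1 ⊗ pathMatrix`. -/
def pathObs (S : Type) [DecidableEq S] (M : ℕ) : Matrix (S × Fin (M + 1)) (S × Fin (M + 1)) ℂ :=
  blockOp (Equiv.prodComm _ _) fun _ => pathMatrix M

theorem isHermitian_pathObs (M : ℕ) : (pathObs S M).IsHermitian := by
  rw [IsHermitian, pathObs, blockOp_conjTranspose]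
  congr 1
  ext _ m m'
  simp only [pathMatrix, conjTranspose_apply, of_apply, star_add, apply_ite star, star_zero]
  rw [add_comm]
  congr 1
  · simp [eq_comm]
  · simp [eq_comm]

/-- The operator `B` on `S`, controlled on the counter exceeding `t`. -/
def controlled {N : ℕ} (t : ℕ) (B : Matrix S S ℂ) : Matrix (S × Fin N) (S × Fin N) ℂ :=
  blockOp (Equiv.refl _) fun m : Fin N => if t < m then B else 1

/-- The operator `B` on `S`, whatever the counter. -/
def uncontrolled {N : ℕ} (B : Matrix S S ℂ) : Matrix (S × Fin N) (S × Fin N) ℂ :=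
  blockOp (Equiv.refl _) fun _ : Fin N => B

variable [Fintype S]

theorem controlled_conjTranspose_mul_self {N : ℕ} (t : ℕ) {B : Matrix S S ℂ} (hB : Bᴴ * B = 1) :
    (controlled t B : Matrix (S × Fin N) (S × Fin N) ℂ)ᴴ * controlled t B = 1 :=
  blockOp_conjTranspose_mul_self _ _ fun m => by split_ifs <;> simp [hB]

/-- The reflection `2|χ⟩⟨χ| - 1`. -/
def reflection (χ : S → ℂ) : Matrix S S ℂ := (2 : ℂ) • ketbra χ - 1

theorem reflection_isHermitian {S : Type} [DecidableEq S] (χ : S → ℂ) : (reflection χ).IsHermitian := by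
  rw [IsHermitian, reflection, conjTranspose_sub, conjTranspose_smul, isHermitian_ketbra]
  simp

theorem reflection_mul_self {χ : S → ℂ} (hχ : star χ ⬝ᵥ χ = 1) :
    reflection χ * reflection χ = 1 := by
  simp only [reflection, sub_mul, mul_sub, Matrix.smul_mul, Matrix.mul_smul, one_mul, mul_one,
    ketbra_mul_ketbra hχ]
  module

theorem reflection_conjTranspose_mul_self {χ : S → ℂ} (hχ : star χ ⬝ᵥ χ = 1) :
    (reflection χ)ᴴ * reflection χ = 1 := by
  rw [reflection_isHermitian, reflection_mul_self hχ]

theorem reflection_mulVec (χ φ : S → ℂ) :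
    reflection χ *ᵥ φ = (2 * (star χ ⬝ᵥ φ)) • χ - φ := by
  rw [reflection, sub_mulVec, smul_mulVec, ketbra, vecMulVec_mulVec, one_mulVec]
  ext s
  simp
  ring

/-- The powers of the product of two reflections satisfy the Chebyshev recursion. -/
theorem chebyshev_recursion {W : Matrix S S ℂ} (hW : W * W = 1) {χ : S → ℂ}
    (hχ : star χ ⬝ᵥ χ = 1) (m : ℕ) :
    ((W * reflection χ) ^ (m + 2)) *ᵥ χ + ((W * reflection χ) ^ m) *ᵥ χ =
      (2 * (star χ ⬝ᵥ W *ᵥ χ)) • ((W * reflection χ) ^ (m + 1)) *ᵥ χ := by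
  have h1 : (W * reflection χ) *ᵥ χ = W *ᵥ χ := by
    rw [← mulVec_mulVec, reflection_mulVec, hχ]
    congr 1
    ext s
    simp
    ring
  -- This is the recursion for m = 0, since the reflection fixes χ; the general case follows by
  -- applying the m-th power.
  have h2 : (W * reflection χ) *ᵥ (W *ᵥ χ) + χ = (2 * (star χ ⬝ᵥ W *ᵥ χ)) • W *ᵥ χ := by
    rw [← mulVec_mulVec, reflection_mulVec, mulVec_sub, mulVec_smul, mulVec_mulVec, hW,
      one_mulVec, sub_add_cancel]
  rw [pow_add, pow_add, ← mulVec_mulVec, ← mulVec_mulVec, pow_one, h1, pow_two, ← mulVec_mulVec,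
    h1, ← mulVec_add, h2, mulVec_smul]

theorem star_mulVec_dotProduct {S' : Type} [Fintype S'] {A : Matrix S' S ℂ} (hA : Aᴴ * A = 1)
    (φ : S → ℂ) : star (A *ᵥ φ) ⬝ᵥ A *ᵥ φ = star φ ⬝ᵥ φ := by
  rw [star_mulVec, ← dotProduct_mulVec, mulVec_mulVec, hA, one_mulVec]

theorem star_dotProduct_self {S : Type} [Fintype S] (φ : S → ℂ) :
    star φ ⬝ᵥ φ = ((∑ s, Complex.normSq (φ s) : ℝ) : ℂ) := by
  push_cast
  exact Finset.sum_congr rfl fun s _ => by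
    rw [Pi.star_apply, Complex.normSq_eq_conj_mul_self, starRingEnd_apply]

theorem sum_normSq_add_le {S : Type} [Fintype S] {x y : S → ℂ} (hx : star x ⬝ᵥ x = 1) (hy : star y ⬝ᵥ y = 1) {a b r : ℝ}
    (ha : |a| ≤ r) (hb : |b| ≤ r) :
    ∑ s, Complex.normSq (a * x s + b * y s) ≤ (2 * r) ^ 2 := by
  rw [star_dotProduct_self] at hx hy
  have hx' : ∑ s, Complex.normSq (x s) = 1 := by exact_mod_cast hx
  have hy' : ∑ s, Complex.normSq (y s) = 1 := by exact_mod_cast hy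
  have hr : 0 ≤ r := (abs_nonneg a).trans ha
  have ha' : a ^ 2 ≤ r ^ 2 := sq_le_sq.2 (by rwa [abs_of_nonneg hr])
  have hb' : b ^ 2 ≤ r ^ 2 := sq_le_sq.2 (by rwa [abs_of_nonneg hr])
  calc _ ≤ ∑ s, (2 * a ^ 2 * Complex.normSq (x s) + 2 * b ^ 2 * Complex.normSq (y s)) := by
        refine Finset.sum_le_sum fun s _ => ?_
        simp only [Complex.normSq_apply, Complex.add_re, Complex.add_im, Complex.re_ofReal_mul,
          Complex.im_ofReal_mul]
        nlinarith [sq_nonneg (a * (x s).re - b * (y s).re), sq_nonneg (a * (x s).im - b * (y s).im)]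
    _ = 2 * a ^ 2 + 2 * b ^ 2 := by
        rw [Finset.sum_add_distrib, ← Finset.mul_sum, ← Finset.mul_sum, hx', hy']; ring
    _ ≤ _ := by nlinarith

/-- The deviation of the probe from an eigenvector of the path observable. -/
theorem sum_normSq_pathMatrix_le {S : Type} [Fintype S] {M : ℕ} (hM : 2 ≤ M) {u : ℕ → S → ℂ}
    (hu : ∀ m, star (u m) ⬝ᵥ u m = 1) {c : ℝ}
    (hrec : ∀ m s, u (m + 2) s + u m s = 2 * c * u (m + 1) s) (m : Fin (M + 1)) :
    ∑ s, Complex.normSq (∑ m' : Fin (M + 1), pathMatrix M m m' * (probeWeight M m' * u m' s) -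
      c * (probeWeight M m * u m s)) ≤ (M : ℝ) ^ 2 := by
  simp only [fun s => sum_pathMatrix_mul M (fun j => probeWeight M j * u j s) m]
  obtain ⟨m, hm⟩ := m
  have hM' : (2 : ℝ) ≤ M := by exact_mod_cast hM
  -- With w the weight, the recursion turns the deviation at an interior m into (w_{m+1} - w_m)/2
  -- times u_{m+1} plus (w_{m-1} - w_m)/2 times u_{m-1}, and consecutive weights differ by at most
  -- M. At both ends w_m = 0, so only the term of the one neighbour remains.
  have key : ∀ (i j : ℕ) (a b : ℝ), |a| ≤ (M : ℝ) / 2 → |b| ≤ (M : ℝ) / 2 →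
      ∑ s, Complex.normSq (a * u i s + b * u j s) ≤ (M : ℝ) ^ 2 := fun i j a b ha hb =>
    (sum_normSq_add_le (hu i) (hu j) ha hb).trans (by ring_nf; rfl)
  cases m with
  | zero =>
    refine le_trans (le_of_eq ?_) (key 1 0 (((M : ℝ) - 1) / 2) 0 ?_ ?_)
    · refine Finset.sum_congr rfl fun s _ => congrArg _ ?_
      simp [probeWeight, show 0 < M by omega]
      ring
    · rw [abs_of_nonneg (by linarith)]; linarith
    · rw [abs_zero]; linarith
  | succ k =>
    rcases Nat.lt_or_ge (k + 1) M with hk | hk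
    · have hk' : (k : ℝ) + 2 ≤ M := by exact_mod_cast hk
      have hk0 : (0 : ℝ) ≤ k := Nat.cast_nonneg k
      refine le_trans (le_of_eq ?_)
        (key (k + 2) k (((M : ℝ) - 2 * k - 3) / 2) (-((M : ℝ) - 2 * k - 1) / 2) ?_ ?_)
      · refine Finset.sum_congr rfl fun s _ => congrArg _ ?_
        have h := hrec k s
        simp only [hk, if_true, Nat.succ_pos, Nat.add_sub_cancel, probeWeight]
        push_cast
        linear_combination ((1 / 2) * ((k : ℂ) + 1) * (M - (k + 1))) * h
      · rw [abs_le]; constructor <;> linarith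
      · rw [abs_le]; constructor <;> linarith
    · obtain rfl : M = k + 1 := by omega
      have hk0 : (1 : ℝ) ≤ k := by exact_mod_cast (show 1 ≤ k by omega)
      refine le_trans (le_of_eq ?_) (key k 0 ((k : ℝ) / 2) 0 ?_ ?_)
      · refine Finset.sum_congr rfl fun s _ => congrArg _ ?_
        simp [probeWeight]
        ring
      · rw [abs_of_nonneg (by linarith)]; push_cast; linarith
      · simp; positivity

variable {Q : Type} {R : Q → Type} {M : ℕ}

/-- `T` rounds of the product of the reflections about `χ` and about the eigenspaces of the
conjugate of `z` by the operator that `fwd` implements and `bwd` inverts, controlled on the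
counter. -/
def amplify (fwd bwd : QProgram (S × Fin (M + 1)) R ℝ → QProgram (S × Fin (M + 1)) R ℝ)
    {z : Matrix S S ℂ} (hz : zᴴ * z = 1) {χ : S → ℂ} (hχ : star χ ⬝ᵥ χ = 1) :
    ℕ → QProgram (S × Fin (M + 1)) R ℝ → QProgram (S × Fin (M + 1)) R ℝ
  | 0, p => p
  | T + 1, p => amplify fwd bwd hz hχ T
      (.gate (controlled T (reflection χ))
        (controlled_conjTranspose_mul_self T (reflection_conjTranspose_mul_self hχ))
        (fwd (.gate (controlled T z) (controlled_conjTranspose_mul_self T hz) (bwd p))))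

/-- The probe state `∑ₘ αₘ |χ⟩|m⟩`. -/
def probe (M : ℕ) (χ : S → ℂ) : S × Fin (M + 1) → ℂ := fun p =>
  χ p.1 * ((probeWeight M p.2 / Real.sqrt (M * ((M : ℝ) ^ 4 - 1) / 30) : ℝ) : ℂ)

theorem star_probe_dotProduct {S : Type} [Fintype S] {M : ℕ} (hM : 2 ≤ M) {χ : S → ℂ} (hχ : star χ ⬝ᵥ χ = 1) :
    star (probe M χ) ⬝ᵥ probe M χ = 1 := by
  have hM' : (2 : ℝ) ≤ M := by exact_mod_cast hM
  have hpos : 0 < M * ((M : ℝ) ^ 4 - 1) / 30 := by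
    have : (1 : ℝ) < (M : ℝ) ^ 4 := one_lt_pow₀ (by linarith) (by norm_num)
    have : 0 < (M : ℝ) ^ 4 - 1 := by linarith
    positivity
  rw [star_dotProduct_self] at hχ ⊢
  have hχ' : ∑ s, Complex.normSq (χ s) = 1 := by exact_mod_cast hχ
  norm_cast
  rw [Fintype.sum_prod_type]
  simp only [probe, Complex.normSq_mul, Complex.normSq_ofReal, ← sq, div_pow,
    Real.sq_sqrt hpos.le, ← Finset.mul_sum, ← Finset.sum_div, ← Finset.sum_mul]
  rw [hχ', one_mul, Fin.sum_univ_eq_sum_range (fun m => probeWeight M m ^ 2),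
    sum_probeWeight_sq, div_self hpos.ne']

/-- Estimate the amplitude `⟨χ|U† z U|χ⟩` with `M` applications of `U` and `U†`. -/
def estimateAmplitude (hM : 2 ≤ M)
    (fwd bwd : QProgram (S × Fin (M + 1)) R ℝ → QProgram (S × Fin (M + 1)) R ℝ)
    {z : Matrix S S ℂ} (hz : zᴴ * z = 1) {χ : S → ℂ} (hχ : star χ ⬝ᵥ χ = 1) :
    QProgram (S × Fin (M + 1)) R ℝ :=
  .prep (probe M χ) (star_probe_dotProduct hM hχ)
    (amplify fwd bwd hz hχ M (.measureObs (isHermitian_pathObs M)))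

theorem queries_amplify_le {a b : ℕ}
    {fwd bwd : QProgram (S × Fin (M + 1)) R ℝ → QProgram (S × Fin (M + 1)) R ℝ}
    {z : Matrix S S ℂ} (hz : zᴴ * z = 1) {χ : S → ℂ} (hχ : star χ ⬝ᵥ χ = 1)
    (hf : ∀ p, (fwd p).queries ≤ p.queries + a) (hb : ∀ p, (bwd p).queries ≤ p.queries + b)
    (T : ℕ) (p : QProgram (S × Fin (M + 1)) R ℝ) :
    (amplify fwd bwd hz hχ T p).queries ≤ p.queries + T * (a + b) := by
  induction T generalizing p with
  | zero => simp [amplify]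
  | succ T ih =>
    refine (ih _).trans ?_
    have h1 := (QProgram.queries_gate_le (controlled T (reflection χ))
      (controlled_conjTranspose_mul_self T (reflection_conjTranspose_mul_self hχ)) _).trans
      ((hf (.gate (controlled T z) (controlled_conjTranspose_mul_self T hz) (bwd p))).trans
        (Nat.add_le_add_right ((QProgram.queries_gate_le _ _ _).trans (hb p)) a))
    rw [Nat.succ_mul]
    omega

theorem queries_estimateAmplitude_le (hM : 2 ≤ M) {a b : ℕ}
    {fwd bwd : QProgram (S × Fin (M + 1)) R ℝ → QProgram (S × Fin (M + 1)) R ℝ}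
    {z : Matrix S S ℂ} (hz : zᴴ * z = 1) {χ : S → ℂ} (hχ : star χ ⬝ᵥ χ = 1)
    (hf : ∀ p, (fwd p).queries ≤ p.queries + a) (hb : ∀ p, (bwd p).queries ≤ p.queries + b) :
    (estimateAmplitude hM fwd bwd hz hχ).queries ≤ M * (a + b) := by
  refine (QProgram.queries_prep_le _ _ _).trans ((queries_amplify_le hz hχ hf hb M _).trans ?_)
  have := QProgram.queries_measureObs (R := R) (isHermitian_pathObs (S := S) M)
  omega

variable [∀ q, Fintype (R q)] {ans : ∀ q, OracleAction (R q)}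

/-- Round T acts only on counters above T, so counter m undergoes min(m, T) of the first T rounds.
The oracle prefixes need no control: where the two controlled gates are idle, U and U† cancel. -/
theorem implements_amplify
    {fwd bwd : QProgram (S × Fin (M + 1)) R ℝ → QProgram (S × Fin (M + 1)) R ℝ}
    {U : Matrix S S ℂ} (hU : Uᴴ * U = 1) (hfwd : QProgram.Implements ans fwd (uncontrolled U))
    (hbwd : QProgram.Implements ans bwd (uncontrolled Uᴴ))
    {z : Matrix S S ℂ} (hz : zᴴ * z = 1) {χ : S → ℂ} (hχ : star χ ⬝ᵥ χ = 1) (T : ℕ) :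
    QProgram.Implements ans (amplify fwd bwd hz hχ T)
      (blockOp (Equiv.refl _) fun m : Fin (M + 1) =>
        (Uᴴ * z * U * reflection χ) ^ min (m : ℕ) T) := by
  induction T with
  | zero =>
    intro p f ρ
    simp [amplify, blockOp_one]
  | succ T ih =>
    have h1 := ih.comp ((QProgram.implements_gate (controlled T (reflection χ))
      (controlled_conjTranspose_mul_self T (reflection_conjTranspose_mul_self hχ))).comp
      (hfwd.comp ((QProgram.implements_gate (controlled T z)
        (controlled_conjTranspose_mul_self T hz)).comp hbwd)))
    suffices h : (uncontrolled Uᴴ * controlled T z * uncontrolled U *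
        controlled T (reflection χ) * blockOp (Equiv.refl (S × Fin (M + 1)))
          fun m => (Uᴴ * z * U * reflection χ) ^ min (m : ℕ) T) =
        blockOp (Equiv.refl _) fun m : Fin (M + 1) =>
          (Uᴴ * z * U * reflection χ) ^ min (m : ℕ) (T + 1) by
      rw [← h]
      exact h1
    simp only [controlled, uncontrolled, blockOp_mul]
    congr 1
    ext m : 1
    split_ifs with hm
    · rw [min_eq_right (by omega), min_eq_right (by omega), pow_succ']
    · rw [min_eq_left (by omega), min_eq_left (by omega)]
      simp [hU]

/-- The mean square error is ‖(O - c)Φ‖² for the path observable O and the final state Φ. Each of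
the M + 1 counter values contributes at most M²/γ², where γ² = M(M⁴ - 1)/30 normalizes the weights.
-/
theorem exists_hasLaw_estimateAmplitude (hans : ∀ q, (ans q).IsChannel) (hM : 2 ≤ M)
    {fwd bwd : QProgram (S × Fin (M + 1)) R ℝ → QProgram (S × Fin (M + 1)) R ℝ}
    {U : Matrix S S ℂ} (hU : Uᴴ * U = 1) (hfwd : QProgram.Implements ans fwd (uncontrolled U))
    (hbwd : QProgram.Implements ans bwd (uncontrolled Uᴴ))
    {z : Matrix S S ℂ} (hz : zᴴ * z = 1) (hz' : z.IsHermitian)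
    {χ : S → ℂ} (hχ : star χ ⬝ᵥ χ = 1) {c : ℝ}
    (hc : (c : ℂ) = star (U *ᵥ χ) ⬝ᵥ z *ᵥ (U *ᵥ χ)) :
    ∃ E, (estimateAmplitude hM fwd bwd hz hχ).HasLaw ans E ∧
      E (fun x => (x - c) ^ 2) ≤ 60 / (M : ℝ) ^ 2 := by
  obtain ⟨E, hE, hf⟩ := QProgram.exists_hasLaw_prep hans (probe M χ) (star_probe_dotProduct hM hχ)
    (amplify fwd bwd hz hχ M (.measureObs (isHermitian_pathObs M)))
  refine ⟨E, hE, ?_⟩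
  have hU' : U * Uᴴ = 1 := mul_eq_one_comm.1 hU
  have hzz : z * z = 1 := by rwa [hz'] at hz
  set W := Uᴴ * z * U with hW
  have hW1 : W * W = 1 := by
    calc W * W = Uᴴ * z * (U * Uᴴ) * z * U := by simp only [hW, mul_assoc]
      _ = 1 := by rw [hU', mul_one, mul_assoc Uᴴ, hzz, mul_one, hU]
  have hWh : Wᴴ = W := by
    simp only [hW, conjTranspose_mul, conjTranspose_conjTranspose, hz'.eq, mul_assoc]
  have hcW : star χ ⬝ᵥ W *ᵥ χ = c := by
    rw [hc, star_mulVec, ← dotProduct_mulVec, mulVec_mulVec, mulVec_mulVec]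
  have hQ : ∀ m, ((W * reflection χ) ^ m)ᴴ * (W * reflection χ) ^ m = 1 := by
    have h1 : (W * reflection χ)ᴴ * (W * reflection χ) = 1 := by
      rw [conjTranspose_mul, hWh, reflection_isHermitian, mul_assoc, ← mul_assoc W, hW1, one_mul,
        reflection_mul_self hχ]
    intro m
    induction m with
    | zero => simp
    | succ m ih =>
      rw [pow_succ', conjTranspose_mul, mul_assoc, ← mul_assoc _ (W * reflection χ), h1, one_mul,
        ih]
  set u : ℕ → S → ℂ := fun m => ((W * reflection χ) ^ m) *ᵥ χ with hu
  have hu1 : ∀ m, star (u m) ⬝ᵥ u m = 1 := fun m => by rw [hu, star_mulVec_dotProduct (hQ m), hχ]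
  have hrec : ∀ m s, u (m + 2) s + u m s = 2 * c * u (m + 1) s := fun m s => by
    have := congrFun (chebyshev_recursion hW1 hχ m) s
    rwa [hcW] at this
  set γ := Real.sqrt (M * ((M : ℝ) ^ 4 - 1) / 30) with hγ
  set Φ : S × Fin (M + 1) → ℂ := fun p => ((1 / γ : ℝ) : ℂ) * (probeWeight M p.2 * u p.2 p.1)
    with hΦ
  set O := pathObs S M with hO
  have hfin : (blockOp (Equiv.refl _) fun m : Fin (M + 1) =>
      (W * reflection χ) ^ min (m : ℕ) M) *ᵥ probe M χ = Φ := by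
    ext p
    rw [blockOp_mulVec]
    simp only [Equiv.refl_apply, Equiv.refl_symm, probe, hΦ, hu, mulVec, dotProduct,
      Finset.mul_sum]
    refine Finset.sum_congr rfl fun s _ => ?_
    rw [min_eq_left (by omega)]
    push_cast
    ring
  have hfΦ : ∀ f, (E f : ℂ) = (QProgram.measureObs (isHermitian_pathObs (S := S) M)).expect ans f
      (ketbra Φ) := fun f => by
    rw [hf, implements_amplify hU hfwd hbwd hz hχ M, mul_ketbra_mul, hfin]
  -- The normalization of the final state is read off from that of the law, since the whole program
  -- preserves the trace.
  have hone : star Φ ⬝ᵥ Φ = 1 := by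
    rw [← trace_ketbra, ← QProgram.expect_one hans
      (QProgram.measureObs (isHermitian_pathObs (S := S) M)), ← hfΦ, E.one, Complex.ofReal_one]
  have hsymm : star (O *ᵥ Φ) = star Φ ᵥ* O := by
    rw [star_mulVec, isHermitian_pathObs]
  -- Both moments are expectation values in Φ, and O is Hermitian, so the second moment about c is a
  -- squared norm.
  have hval : E (fun x => (x - c) ^ 2) =
      ∑ p, Complex.normSq ((O *ᵥ Φ - (c : ℂ) • Φ) p) := by
    rw [← Complex.ofReal_inj, ← star_dotProduct_self, E.map_sub_sq]
    push_cast
    rw [hfΦ, hfΦ, QProgram.expect_measureObs_id, QProgram.expect_measureObs_sq, trace_mul_ketbra,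
      trace_mul_ketbra, star_sub, hsymm, sub_dotProduct, dotProduct_sub, dotProduct_sub,
      ← dotProduct_mulVec, ← dotProduct_mulVec, mulVec_mulVec, star_smul, smul_dotProduct,
      smul_dotProduct, dotProduct_smul, mulVec_smul, dotProduct_smul, hone]
    simp
    ring
  rw [hval, Fintype.sum_prod_type_right]
  have hM' : (2 : ℝ) ≤ M := by exact_mod_cast hM
  have h4 : (1 : ℝ) < (M : ℝ) ^ 4 := one_lt_pow₀ (by linarith) (by norm_num)
  have hpos : 0 < M * ((M : ℝ) ^ 4 - 1) / 30 := by
    have : 0 < (M : ℝ) ^ 4 - 1 := by linarith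
    positivity
  have hterm : ∀ m : Fin (M + 1), ∑ s, Complex.normSq ((O *ᵥ Φ - (c : ℂ) • Φ) (s, m)) ≤
      (1 / γ) ^ 2 * (M : ℝ) ^ 2 := fun m => by
    refine le_trans (le_of_eq ?_) (mul_le_mul_of_nonneg_left
      (sum_normSq_pathMatrix_le hM hu1 hrec m) (sq_nonneg (1 / γ)))
    rw [Finset.mul_sum]
    refine Finset.sum_congr rfl fun s _ => ?_
    rw [sq, ← Complex.normSq_ofReal, ← Complex.normSq_mul]
    congr 1
    rw [Pi.sub_apply, hO, pathObs, blockOp_mulVec, mul_sub, Finset.mul_sum]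
    simp only [hΦ, Equiv.prodComm_apply, Prod.swap_prod_mk, Equiv.prodComm_symm, Pi.smul_apply,
      smul_eq_mul]
    congr 1
    · refine Finset.sum_congr rfl fun m' _ => ?_
      ring
    · ring
  refine (Finset.sum_le_sum fun m _ => hterm m).trans ?_
  rw [Finset.sum_const, Finset.card_univ, Fintype.card_fin, nsmul_eq_mul, div_pow, hγ,
    Real.sq_sqrt hpos.le, one_pow, one_div_mul_eq_div, ← mul_div_assoc, div_le_div_iff₀ hpos
    (by positivity)]
  push_cast
  -- Divided by M(M + 1), the claim is M³ ≤ 2(M - 1)(M² + 1), which is true from M = 2 on.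
  nlinarith [mul_nonneg (mul_nonneg (sub_nonneg.2 hM') (sub_nonneg.2 hM')) (sub_nonneg.2 hM')]

end Amplitude

/-! ### Circuits that ignore the counter -/

/-- A tensor factor of `S` as a tensor factor of `S × N`. -/
def Equiv.withCounter {S A T : Type} (e : S ≃ A × T) (N : Type) : S × N ≃ A × (T × N) :=
  (e.prodCongr (Equiv.refl N)).trans (Equiv.prodAssoc A T N)

theorem blockOp_withCounter {S A T : Type} [DecidableEq T] {N : ℕ} (e : S ≃ A × T)
    (V : Matrix A A ℂ) : blockOp (e.withCounter (Fin N)) (fun _ => V) =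
      uncontrolled (blockOp e fun _ => V) := by
  ext s t
  simp only [uncontrolled, blockOp_apply, Equiv.withCounter, Equiv.refl_apply, Equiv.trans_apply,
    Equiv.prodCongr_apply, Prod.map, Equiv.prodAssoc_apply, Prod.mk.injEq]
  split_ifs <;> simp_all

theorem uncontrolled_mul {S : Type} [Fintype S] {N : ℕ} (A B : Matrix S S ℂ) :
    (uncontrolled A * uncontrolled B : Matrix (S × Fin N) (S × Fin N) ℂ) = uncontrolled (A * B) :=
  blockOp_mul _ _ _

theorem uncontrolled_conjTranspose_mul_self {S : Type} [Fintype S] [DecidableEq S] {N : ℕ}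
    {A : Matrix S S ℂ} (hA : Aᴴ * A = 1) :
    (uncontrolled A : Matrix (S × Fin N) (S × Fin N) ℂ)ᴴ * uncontrolled A = 1 :=
  blockOp_conjTranspose_mul_self _ _ fun _ => hA

theorem QProgram.implements_query_withCounter {S Q α : Type} [Fintype S] [DecidableEq S]
    {R : Q → Type} [∀ q, Fintype (R q)] {ans : ∀ q, OracleAction (R q)} {q : Q}
    {V : Matrix (R q) (R q) ℂ} (hq : ans q = .gate V) (T : Type) [Fintype T] [DecidableEq T]
    (e : S ≃ R q × T) (N : ℕ) :
    Implements ans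
      (query q (T × Fin N) (e.withCounter (Fin N)) :
        QProgram (S × Fin N) R α → QProgram (S × Fin N) R α)
      (uncontrolled (blockOp e fun _ => V)) := by
  rw [← blockOp_withCounter]
  exact implements_query hq _ _

/-! ### Block operators and vectors -/

theorem blockOp_mulVec_eq {S R T : Type} [Fintype S] [Fintype R] [Fintype T] [DecidableEq T]
    (e : S ≃ R × T) (B : T → Matrix R R ℂ) (φ : S → ℂ) (s : S) :
    (blockOp e B *ᵥ φ) s = (B (e s).2 *ᵥ fun r => φ (e.symm (r, (e s).2))) (e s).1 :=
  blockOp_mulVec e B φ s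

theorem star_dotProduct_blockOp_mulVec {S R T : Type} [Fintype S] [Fintype R] [Fintype T]
    [DecidableEq T] (e : S ≃ R × T) (B : T → Matrix R R ℂ) (φ : S → ℂ) :
    star φ ⬝ᵥ blockOp e B *ᵥ φ =
      ∑ t, (star fun r => φ (e.symm (r, t))) ⬝ᵥ (B t *ᵥ fun r => φ (e.symm (r, t))) := by
  rw [dotProduct, ← e.symm.sum_comp, Fintype.sum_prod_type_right]
  refine Finset.sum_congr rfl fun t _ => Finset.sum_congr rfl fun r _ => ?_
  rw [blockOp_mulVec_eq, Equiv.apply_symm_apply]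
  rfl

section Coherent

variable {K : ℕ} {A : Type}

theorem coherent_eq_blockOp (F : Fin K → Matrix A A ℂ) :
    coherent F = blockOp (Equiv.prodComm _ _) F := by
  ext p q
  rw [blockOp_apply]
  rfl

theorem coherent_mulVec [Fintype A] (F : Fin K → Matrix A A ℂ) (φ : Fin K × A → ℂ)
    (p : Fin K × A) : (coherent F *ᵥ φ) p = (F p.1 *ᵥ fun r => φ (p.1, r)) p.2 := by
  rw [coherent_eq_blockOp, blockOp_mulVec_eq]
  rfl

theorem coherent_mul [Fintype A] (F F' : Fin K → Matrix A A ℂ) :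
    coherent F * coherent F' = coherent fun k => F k * F' k := by
  simp only [coherent_eq_blockOp, blockOp_mul]

theorem coherent_conjTranspose (F : Fin K → Matrix A A ℂ) :
    (coherent F)ᴴ = coherent fun k => (F k)ᴴ := by
  simp only [coherent_eq_blockOp, blockOp_conjTranspose]

theorem coherent_one [DecidableEq A] : coherent (fun _ : Fin K => (1 : Matrix A A ℂ)) = 1 := by
  rw [coherent_eq_blockOp, blockOp_one]

theorem coherent_conjTranspose_mul_self [Fintype A] [DecidableEq A] {F : Fin K → Matrix A A ℂ}
    (hF : ∀ k, (F k)ᴴ * F k = 1) : (coherent F)ᴴ * coherent F = 1 := by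
  simp only [coherent_conjTranspose, coherent_mul, hF, coherent_one]

theorem conj_reflection [Fintype A] [DecidableEq A] {F : Matrix A A ℂ} (hF : F * Fᴴ = 1)
    (χ : A → ℂ) : F * (reflection χ * Fᴴ) = reflection (F *ᵥ χ) := by
  rw [reflection, reflection, ← mul_assoc, mul_sub, sub_mul, Matrix.mul_smul, Matrix.smul_mul,
    mul_ketbra_mul, mul_one, hF]

end Coherent

/-! ### The registers of the algorithm with purified Gibbs states -/

section Purified

variable {n h K d : ℕ}

/-- Two control qubits, the index, a data register with label, two purified Gibbs states. -/
abbrev PurifiedReg (n h K d : ℕ) : Type :=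
  (Fin 2 × Fin 2) × Fin K × (Qubits n × Fin 2) × (Hid h × Fin d) × (Hid h × Fin d)

/-- The index with the data register and its label. -/
def dataEquiv : PurifiedReg n h K d ≃
    (Fin K × (Qubits n × Fin 2)) × ((Fin 2 × Fin 2) × (Hid h × Fin d) × (Hid h × Fin d)) where
  toFun s := ((s.2.1, s.2.2.1), (s.1, s.2.2.2))
  invFun t := (t.2.1, t.1.1, t.1.2, t.2.2)
  left_inv _ := rfl
  right_inv _ := rfl

/-- The index with the first Gibbs state. -/
def fstGibbsEquiv : PurifiedReg n h K d ≃
    (Fin K × (Hid h × Fin d)) × ((Fin 2 × Fin 2) × (Qubits n × Fin 2) × (Hid h × Fin d)) where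
  toFun s := ((s.2.1, s.2.2.2.1), (s.1, s.2.2.1, s.2.2.2.2))
  invFun t := (t.2.1, t.1.1, t.2.2.1, t.1.2, t.2.2.2)
  left_inv _ := rfl
  right_inv _ := rfl

/-- The index with the second Gibbs state. -/
def sndGibbsEquiv : PurifiedReg n h K d ≃
    (Fin K × (Hid h × Fin d)) × ((Fin 2 × Fin 2) × (Qubits n × Fin 2) × (Hid h × Fin d)) where
  toFun s := ((s.2.1, s.2.2.2.2), (s.1, s.2.2.1, s.2.2.2.1))
  invFun t := (t.2.1, t.1.1, t.2.2.1, t.2.2.2, t.1.2)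
  left_inv _ := rfl
  right_inv _ := rfl

/-- The index with the data register and the label qubit of the second Gibbs state. -/
def sndLabelEquiv : PurifiedReg n h K d ≃
    (Fin K × (Qubits n × Fin 2)) ×
      ((Fin 2 × Fin 2) × Fin 2 × (Hid h × Fin d) × Qubits h × Fin d) where
  toFun s := ((s.2.1, (s.2.2.1.1, s.2.2.2.2.1.2)),
    (s.1, s.2.2.1.2, s.2.2.2.1, s.2.2.2.2.1.1, s.2.2.2.2.2))
  invFun t := (t.2.1, t.1.1, (t.1.2.1, t.2.2.1), t.2.2.2.1, ((t.2.2.2.2.1, t.1.2.2), t.2.2.2.2.2))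
  left_inv _ := rfl
  right_inv _ := rfl

/-- The first control qubit with the data register and, depending on the second control qubit,
the second or the first Gibbs state. -/
def obsEquiv : PurifiedReg n h K d ≃
    (Fin 2 × Full n h) × (Fin 2 × Fin K × Fin 2 × Fin d × (Hid h × Fin d)) where
  toFun s := if s.1.2 = 0 then
      ((s.1.1, (s.2.2.1.1, s.2.2.2.2.1)), (s.1.2, s.2.1, s.2.2.1.2, s.2.2.2.2.2, s.2.2.2.1))
    else ((s.1.1, (s.2.2.1.1, s.2.2.2.1.1)), (s.1.2, s.2.1, s.2.2.1.2, s.2.2.2.1.2, s.2.2.2.2))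
  invFun t := if t.2.1 = 0 then
      ((t.1.1, t.2.1), t.2.2.1, (t.1.2.1, t.2.2.2.1), t.2.2.2.2.2, (t.1.2.2, t.2.2.2.2.1))
    else ((t.1.1, t.2.1), t.2.2.1, (t.1.2.1, t.2.2.2.1), (t.1.2.2, t.2.2.2.2.1), t.2.2.2.2.2)
  left_inv s := by
    by_cases hs : s.1.2 = 0
    · simp [hs]
      simp [← hs]
    · simp [hs]
  right_inv t := by
    by_cases ht : t.2.1 = 0
    · simp [ht]
      simp [← ht]
    · simp [ht]

/-- The phase flip of the label test, switched off by the first control. -/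
def labelFlip (n h K d : ℕ) : Matrix (PurifiedReg n h K d) (PurifiedReg n h K d) ℂ :=
  blockOp sndLabelEquiv fun t => if t.1.1 = 0 then coherent fun _ => reflection (ket 0) else 1

/-- The observable whose expectation value is the covariance. -/
def covObs (K d : ℕ) (O : Matrix (Full n h) (Full n h) ℂ) :
    Matrix (PurifiedReg n h K d) (PurifiedReg n h K d) ℂ :=
  blockOp obsEquiv fun t => (if t.1 = 0 then 1 else -1 : ℂ) • (!![0, 1; 1, 0] ⊗ₖ O)

theorem covObs_isHermitian {O : Matrix (Full n h) (Full n h) ℂ} (hO : O.IsHermitian) :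
    (covObs K d O).IsHermitian := by
  have hX : (!![0, 1; 1, 0] : Matrix (Fin 2) (Fin 2) ℂ)ᴴ = !![0, 1; 1, 0] := by
    ext i j
    fin_cases i <;> fin_cases j <;> simp
  rw [IsHermitian, covObs, blockOp_conjTranspose]
  congr 1
  ext t : 1
  rw [conjTranspose_smul, conjTranspose_kronecker, hX, hO]
  congr 1
  split_ifs <;> simp

theorem covObs_conjTranspose_mul_self {O : Matrix (Full n h) (Full n h) ℂ} (hO : O.IsHermitian)
    (hO' : O * O = 1) : (covObs K d O)ᴴ * covObs K d O = 1 := by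
  have hX : (!![0, 1; 1, 0] : Matrix (Fin 2) (Fin 2) ℂ) * !![0, 1; 1, 0] = 1 := by
    ext i j
    fin_cases i <;> fin_cases j <;> simp
  rw [covObs_isHermitian hO, covObs, blockOp_mul, ← blockOp_one obsEquiv]
  congr 1
  ext t : 1
  rw [Matrix.smul_mul, Matrix.mul_smul, ← mul_kronecker_mul, hX, hO', one_kronecker_one, smul_smul]
  split_ifs <;> simp

theorem labelFlip_conjTranspose : (labelFlip n h K d)ᴴ = labelFlip n h K d := by
  rw [labelFlip, blockOp_conjTranspose]
  congr 1
  ext t : 1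
  split_ifs
  · simp only [coherent_conjTranspose]
    congr 1
    ext k : 1
    rw [reflection_isHermitian]
  · rw [conjTranspose_one]

theorem labelFlip_conjTranspose_mul_self : (labelFlip n h K d)ᴴ * labelFlip n h K d = 1 := by
  refine blockOp_conjTranspose_mul_self _ _ fun t => ?_
  split_ifs
  · exact coherent_conjTranspose_mul_self fun _ =>
      reflection_conjTranspose_mul_self (star_ket_dotProduct_ket 0)
  · simp

variable [NeZero d]

/-- The uniform superposition of the controls and of the index. -/
def startVec (n h K d : ℕ) [NeZero d] : PurifiedReg n h K d → ℂ := fun s =>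
  -- There are 4K basis states of the two controls and the index.
  ((1 / Real.sqrt (4 * K) : ℝ) : ℂ) * (ket 0 s.2.2.1 * (ket 0 s.2.2.2.1 * ket 0 s.2.2.2.2))

theorem star_startVec_dotProduct (hK : 0 < K) :
    star (startVec n h K d) ⬝ᵥ startVec n h K d = 1 := by
  have hnorm : ∀ {A : Type} [Fintype A] [DecidableEq A] (a : A),
      ∑ r, Complex.normSq (ket a r) = 1 := fun a => by
    have := star_ket_dotProduct_ket a
    rw [star_dotProduct_self] at this
    exact_mod_cast this
  rw [star_dotProduct_self]
  norm_cast
  simp only [startVec, Complex.normSq_mul, Complex.normSq_ofReal]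
  have h1 : ∀ x : Fin 2 × Fin 2, 
      ∑ y : Fin K × (Qubits n × Fin 2) × (Hid h × Fin d) × (Hid h × Fin d),
      1 / √(4 * K) * (1 / √(4 * K)) * (Complex.normSq (ket 0 y.2.1) *
        (Complex.normSq (ket 0 y.2.2.1) * Complex.normSq (ket 0 y.2.2.2))) = 1 / 4 := fun _ => by
    rw [Fintype.sum_prod_type]
    simp only [← Finset.mul_sum, Fintype.sum_prod_type (γ := ℝ) (α₁ := Qubits n × Fin 2)
      (α₂ := (Hid h × Fin d) × (Hid h × Fin d)), Fintype.sum_prod_type (γ := ℝ)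
      (α₁ := Hid h × Fin d) (α₂ := Hid h × Fin d), hnorm, mul_one]
    have : (K : ℝ) ≠ 0 := by positivity
    rw [Finset.sum_const, Finset.card_univ, Fintype.card_fin, nsmul_eq_mul, mul_left_comm, ← sq,
      div_pow, Real.sq_sqrt (by positivity)]
    field_simp
  rw [Fintype.sum_prod_type]
  refine (Finset.sum_congr rfl fun x _ => h1 x).trans ?_
  simp

end Purified

/-! ### The preparation circuit and the covariance as a single amplitude -/

section Purified

variable {n h K d : ℕ}
  {F : Fin K → Matrix (Qubits n × Fin 2) (Qubits n × Fin 2) ℂ}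
  {G : Matrix (Fin K × (Hid h × Fin d)) (Fin K × (Hid h × Fin d)) ℂ}
  {v : Fin K → EuclideanSpace ℂ (Qubits n)} {ℓ : Fin K → EuclideanSpace ℂ (Fin 2)}
  {τ : Fin K → Matrix (Hid h) (Hid h) ℂ} {ψ : Fin K → Hid h × Fin d → ℂ}

/-- The unitary that prepares the data and the Gibbs states and tests the label. -/
def prepUnitary (F : Fin K → Matrix (Qubits n × Fin 2) (Qubits n × Fin 2) ℂ)
    (G : Matrix (Fin K × (Hid h × Fin d)) (Fin K × (Hid h × Fin d)) ℂ) :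
    Matrix (PurifiedReg n h K d) (PurifiedReg n h K d) ℂ :=
  blockOp sndLabelEquiv (fun _ => coherent F) * labelFlip n h K d *
    blockOp sndLabelEquiv (fun _ => (coherent F)ᴴ) * blockOp sndGibbsEquiv (fun _ => G) *
      blockOp fstGibbsEquiv (fun _ => G) * blockOp dataEquiv fun _ => coherent F

/-- The program prefix for `prepUnitary`. -/
def prepForward (n h K d N : ℕ)
    (p : QProgram (PurifiedReg n h K d × Fin N) (PurifiedQuery.reg n h K d) ℝ) :
    QProgram (PurifiedReg n h K d × Fin N) (PurifiedQuery.reg n h K d) ℝ :=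
  .query .F (_ × Fin N) (dataEquiv.withCounter (Fin N)) <|
  .query .G (_ × Fin N) (fstGibbsEquiv.withCounter (Fin N)) <|
  .query .G (_ × Fin N) (sndGibbsEquiv.withCounter (Fin N)) <|
  .query .Finv (_ × Fin N) (sndLabelEquiv.withCounter (Fin N)) <|
  .gate (uncontrolled (labelFlip n h K d))
    (uncontrolled_conjTranspose_mul_self labelFlip_conjTranspose_mul_self) <|
  .query .F (_ × Fin N) (sndLabelEquiv.withCounter (Fin N)) p

/-- The program prefix for the inverse of `prepUnitary`. -/
def prepBackward (n h K d N : ℕ)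
    (p : QProgram (PurifiedReg n h K d × Fin N) (PurifiedQuery.reg n h K d) ℝ) :
    QProgram (PurifiedReg n h K d × Fin N) (PurifiedQuery.reg n h K d) ℝ :=
  .query .Finv (_ × Fin N) (sndLabelEquiv.withCounter (Fin N)) <|
  .gate (uncontrolled (labelFlip n h K d))
    (uncontrolled_conjTranspose_mul_self labelFlip_conjTranspose_mul_self) <|
  .query .F (_ × Fin N) (sndLabelEquiv.withCounter (Fin N)) <|
  .query .Ginv (_ × Fin N) (sndGibbsEquiv.withCounter (Fin N)) <|
  .query .Ginv (_ × Fin N) (fstGibbsEquiv.withCounter (Fin N)) <|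
  .query .Finv (_ × Fin N) (dataEquiv.withCounter (Fin N)) p

theorem queries_prepForward_le (N : ℕ)
    (p : QProgram (PurifiedReg n h K d × Fin N) (PurifiedQuery.reg n h K d) ℝ) :
    (prepForward n h K d N p).queries ≤ p.queries + 5 :=
  -- Four queries precede the gate and one follows it.
  Nat.add_le_add_right (QProgram.queries_gate_le (uncontrolled (labelFlip n h K d))
    (uncontrolled_conjTranspose_mul_self labelFlip_conjTranspose_mul_self) _) 4

theorem queries_prepBackward_le (N : ℕ)
    (p : QProgram (PurifiedReg n h K d × Fin N) (PurifiedQuery.reg n h K d) ℝ) :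
    (prepBackward n h K d N p).queries ≤ p.queries + 5 :=
  Nat.add_le_add_right (QProgram.queries_gate_le (uncontrolled (labelFlip n h K d))
    (uncontrolled_conjTranspose_mul_self labelFlip_conjTranspose_mul_self) _) 1

theorem implements_prepForward (N : ℕ) :
    QProgram.Implements (purifiedOracle F G) (prepForward n h K d N)
      (uncontrolled (prepUnitary F G)) := by
  have h1 := (QProgram.implements_query_withCounter (ans := purifiedOracle F G) (q := .F)
      (α := ℝ) rfl _ dataEquiv N).comp
    ((QProgram.implements_query_withCounter (q := .G) rfl _ fstGibbsEquiv N).comp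
    ((QProgram.implements_query_withCounter (q := .G) rfl _ sndGibbsEquiv N).comp
    ((QProgram.implements_query_withCounter (q := .Finv) rfl _ sndLabelEquiv N).comp
    ((QProgram.implements_gate (uncontrolled (labelFlip n h K d))
      (uncontrolled_conjTranspose_mul_self labelFlip_conjTranspose_mul_self)).comp
    (QProgram.implements_query_withCounter (q := .F) rfl _ sndLabelEquiv N)))))
  simp only [uncontrolled_mul] at h1
  exact h1

theorem implements_prepBackward (N : ℕ) :
    QProgram.Implements (purifiedOracle F G) (prepBackward n h K d N)
      (uncontrolled (prepUnitary F G)ᴴ) := by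
  have h1 := (QProgram.implements_query_withCounter (ans := purifiedOracle F G) (q := .Finv)
      (α := ℝ) rfl _ sndLabelEquiv N).comp
    ((QProgram.implements_gate (uncontrolled (labelFlip n h K d))
      (uncontrolled_conjTranspose_mul_self labelFlip_conjTranspose_mul_self)).comp
    ((QProgram.implements_query_withCounter (q := .F) rfl _ sndLabelEquiv N).comp
    ((QProgram.implements_query_withCounter (q := .Ginv) rfl _ sndGibbsEquiv N).comp
    ((QProgram.implements_query_withCounter (q := .Ginv) rfl _ fstGibbsEquiv N).comp
    (QProgram.implements_query_withCounter (q := .Finv) rfl _ dataEquiv N)))))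
  simp only [uncontrolled_mul] at h1
  have h2 : (prepUnitary F G)ᴴ = blockOp dataEquiv (fun _ => (coherent F)ᴴ) *
      (blockOp fstGibbsEquiv (fun _ => Gᴴ) * (blockOp sndGibbsEquiv (fun _ => Gᴴ) *
      (blockOp sndLabelEquiv (fun _ => coherent F) * (labelFlip n h K d *
        blockOp sndLabelEquiv (fun _ => (coherent F)ᴴ))))) := by
    simp only [prepUnitary, conjTranspose_mul, blockOp_conjTranspose, labelFlip_conjTranspose,
      conjTranspose_conjTranspose]
  rw [h2]
  simp only [← mul_assoc] at h1 ⊢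
  exact h1

theorem isUnitary_prepUnitary (hF : IsDataOracle v ℓ F) (hG : Gᴴ * G = 1) :
    (prepUnitary F G)ᴴ * prepUnitary F G = 1 := by
  have hF1 : ∀ k, (F k)ᴴ * F k = 1 := fun k => Matrix.mem_unitaryGroup_iff'.1 (hF k).1
  have hcF : (coherent F)ᴴ * coherent F = 1 := coherent_conjTranspose_mul_self hF1
  have hcF' : ((coherent F)ᴴ)ᴴ * (coherent F)ᴴ = 1 := by
    rw [conjTranspose_conjTranspose]
    exact mul_eq_one_comm.1 hcF
  have hmul : ∀ {A B : Matrix (PurifiedReg n h K d) (PurifiedReg n h K d) ℂ},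
      Aᴴ * A = 1 → Bᴴ * B = 1 → (A * B)ᴴ * (A * B) = 1 := fun {A B} hA hB => by
    rw [conjTranspose_mul, mul_assoc, ← mul_assoc _ A, hA, one_mul, hB]
  exact hmul (hmul (hmul (hmul (hmul (blockOp_conjTranspose_mul_self _ _ fun _ => hcF)
    labelFlip_conjTranspose_mul_self) (blockOp_conjTranspose_mul_self _ _ fun _ => hcF'))
    (blockOp_conjTranspose_mul_self _ _ fun _ => hG))
    (blockOp_conjTranspose_mul_self _ _ fun _ => hG))
    (blockOp_conjTranspose_mul_self _ _ fun _ => hcF)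

/-- The reflection about the label `ℓ`, switched off by the control. -/
def labelReflection (h : ℕ) (ℓ : EuclideanSpace ℂ (Fin 2)) (c : Fin 2) :
    Matrix (Hid h) (Hid h) ℂ :=
  if c = 0 then (2 : ℂ) • hidProj h ℓ - 1 else 1

theorem hidProj_mulVec (h : ℕ) (ℓ : EuclideanSpace ℂ (Fin 2)) (f : Hid h → ℂ) (y : Hid h) :
    (hidProj h ℓ *ᵥ f) y = ℓ y.2 * ∑ z, star (ℓ z) * f (y.1, z) := by
  rw [mulVec, dotProduct, Fintype.sum_prod_type, Finset.sum_eq_single y.1]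
  · rw [Finset.mul_sum]
    refine Finset.sum_congr rfl fun z _ => ?_
    simp [hidProj, ketbra, vecMulVec_apply]
    ring
  · intro x _ hx
    refine Finset.sum_eq_zero fun z _ => ?_
    simp [hidProj, Ne.symm hx]
  · simp

/-- The state from which the covariance is read off. -/
theorem prepUnitary_mulVec [NeZero d] (hF : IsDataOracle v ℓ F) (hv : ∀ k, ‖v k‖ = 1)
    (hG : ∀ k, G *ᵥ ket (k, 0) = fun p => ket k p.1 * ψ k p.2) (s : PurifiedReg n h K d) :
    (prepUnitary F G *ᵥ startVec n h K d) s =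
      ((1 / Real.sqrt (4 * K) : ℝ) : ℂ) * v s.2.1 s.2.2.1.1 * ℓ s.2.1 s.2.2.1.2 *
        ψ s.2.1 s.2.2.2.1 *
        (labelReflection h (ℓ s.2.1) s.1.1 *ᵥ fun y => ψ s.2.1 (y, s.2.2.2.2.2)) s.2.2.2.2.1 := by
  set κ : ℂ := ((1 / Real.sqrt (4 * K) : ℝ) : ℂ) with hκ
  -- G is specified only on the vectors |k⟩|0⟩; superpositions of these follow by linearity.
  have hGf : ∀ f : Fin K → ℂ, G *ᵥ (fun r => f r.1 * ket 0 r.2) = fun p => f p.1 * ψ p.1 p.2 := by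
    intro f
    have h1 : (fun r : Fin K × (Hid h × Fin d) => f r.1 * ket 0 r.2) =
        ∑ k, f k • ket (k, 0) := by
      ext ⟨k, y⟩
      rw [Finset.sum_apply, Finset.sum_eq_single k]
      · rw [Pi.smul_apply, ket_prod k k 0 y, smul_eq_mul]
        simp [ket]
      · intro k' _ hk
        rw [Pi.smul_apply, ket_prod k' k 0 y]
        simp [ket, hk.symm]
      · simp
    rw [h1, mulVec_sum]
    ext ⟨k, y⟩
    simp only [mulVec_smul, hG, Finset.sum_apply, Pi.smul_apply, smul_eq_mul]
    rw [Finset.sum_eq_single k]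
    · simp [ket]
    · intro k' _ hk
      simp [ket, hk.symm]
    · simp
  have h1 : blockOp dataEquiv (fun _ => coherent F) *ᵥ startVec n h K d = fun s =>
      κ * v s.2.1 s.2.2.1.1 * ℓ s.2.1 s.2.2.1.2 * ket 0 s.2.2.2.1 * ket 0 s.2.2.2.2 := by
    ext s
    rw [blockOp_mulVec_eq, coherent_mulVec]
    change (F s.2.1 *ᵥ fun r => κ * (ket 0 r * (ket 0 s.2.2.2.1 * ket 0 s.2.2.2.2))) s.2.2.1 = _
    have : (fun r : Qubits n × Fin 2 => κ * (ket 0 r * (ket 0 s.2.2.2.1 * ket 0 s.2.2.2.2))) =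
        (κ * ket 0 s.2.2.2.1 * ket 0 s.2.2.2.2) • ket 0 := by
      ext r
      rw [Pi.smul_apply, smul_eq_mul]
      ring
    rw [this, mulVec_smul, (hF _).2, Pi.smul_apply, smul_eq_mul]
    ring
  have h2 : blockOp fstGibbsEquiv (fun _ => G) *ᵥ (fun s : PurifiedReg n h K d =>
      κ * v s.2.1 s.2.2.1.1 * ℓ s.2.1 s.2.2.1.2 * ket 0 s.2.2.2.1 * ket 0 s.2.2.2.2) = fun s =>
      κ * v s.2.1 s.2.2.1.1 * ℓ s.2.1 s.2.2.1.2 * ψ s.2.1 s.2.2.2.1 * ket 0 s.2.2.2.2 := by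
    ext s
    rw [blockOp_mulVec_eq]
    change (G *ᵥ fun r => κ * v r.1 s.2.2.1.1 * ℓ r.1 s.2.2.1.2 * ket 0 r.2 *
      ket 0 s.2.2.2.2) (s.2.1, s.2.2.2.1) = _
    have : (fun r : Fin K × (Hid h × Fin d) => κ * v r.1 s.2.2.1.1 * ℓ r.1 s.2.2.1.2 *
        ket 0 r.2 * ket 0 s.2.2.2.2) =
        fun r => (κ * v r.1 s.2.2.1.1 * ℓ r.1 s.2.2.1.2 * ket 0 s.2.2.2.2) * ket 0 r.2 := by
      ext r
      ring
    rw [this, hGf fun k => κ * v k s.2.2.1.1 * ℓ k s.2.2.1.2 * ket 0 s.2.2.2.2]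
    ring
  have h3 : blockOp sndGibbsEquiv (fun _ => G) *ᵥ (fun s : PurifiedReg n h K d =>
      κ * v s.2.1 s.2.2.1.1 * ℓ s.2.1 s.2.2.1.2 * ψ s.2.1 s.2.2.2.1 * ket 0 s.2.2.2.2) = fun s =>
      κ * v s.2.1 s.2.2.1.1 * ℓ s.2.1 s.2.2.1.2 * ψ s.2.1 s.2.2.2.1 * ψ s.2.1 s.2.2.2.2 := by
    ext s
    rw [blockOp_mulVec_eq]
    change (G *ᵥ fun r => κ * v r.1 s.2.2.1.1 * ℓ r.1 s.2.2.1.2 * ψ r.1 s.2.2.2.1 *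
      ket 0 r.2) (s.2.1, s.2.2.2.2) = _
    rw [hGf fun k => κ * v k s.2.2.1.1 * ℓ k s.2.2.1.2 * ψ k s.2.2.2.1]
  -- Conjugation by F turns the reflection about |0⟩ into the one about |v_k⟩|ℓ_k⟩; with the flip
  -- switched off, F and its inverse cancel.
  have h4 : (blockOp sndLabelEquiv (fun _ => coherent F) * labelFlip n h K d *
      blockOp sndLabelEquiv (fun _ => (coherent F)ᴴ) : Matrix (PurifiedReg n h K d) _ ℂ) =
      blockOp sndLabelEquiv fun t => if t.1.1 = 0 then
        coherent fun k => reflection fun p => v k p.1 * ℓ k p.2 else 1 := by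
    have hF1 : ∀ k, F k * (F k)ᴴ = 1 := fun k => Matrix.mem_unitaryGroup_iff.1 (hF k).1
    rw [labelFlip, blockOp_mul, blockOp_mul]
    congr 1
    ext t : 1
    split_ifs
    · simp only [coherent_conjTranspose, coherent_mul, mul_assoc, conj_reflection (hF1 _),
        (hF _).2]
    · simp only [mul_one, coherent_conjTranspose, coherent_mul, hF1, coherent_one]
  simp only [prepUnitary, ← mulVec_mulVec, h1, h2, h3]
  simp only [mulVec_mulVec, ← mul_assoc, h4]
  rw [blockOp_mulVec_eq]
  by_cases hc : s.1.1 = 0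
  · rw [if_pos (show (sndLabelEquiv s).2.1.1 = 0 from hc), coherent_mulVec]
    change (reflection (fun p : Qubits n × Fin 2 => v s.2.1 p.1 * ℓ s.2.1 p.2) *ᵥ fun r =>
      κ * v s.2.1 r.1 * ℓ s.2.1 s.2.2.1.2 * ψ s.2.1 s.2.2.2.1 *
        ψ s.2.1 ((s.2.2.2.2.1.1, r.2), s.2.2.2.2.2)) (s.2.2.1.1, s.2.2.2.2.1.2) = _
    -- The data register already holds the unit vector v_k, so only the overlap of the label qubit
    -- with ℓ_k remains.
    have hdot : (star fun p : Qubits n × Fin 2 => v s.2.1 p.1 * ℓ s.2.1 p.2) ⬝ᵥ (fun r =>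
        κ * v s.2.1 r.1 * ℓ s.2.1 s.2.2.1.2 * ψ s.2.1 s.2.2.2.1 *
          ψ s.2.1 ((s.2.2.2.2.1.1, r.2), s.2.2.2.2.2)) =
        κ * ℓ s.2.1 s.2.2.1.2 * ψ s.2.1 s.2.2.2.1 *
          ∑ z, star (ℓ s.2.1 z) * ψ s.2.1 ((s.2.2.2.2.1.1, z), s.2.2.2.2.2) := by
      have h5 := star_dotProduct_of_norm_eq_one (hv s.2.1)
      rw [← one_mul (κ * ℓ s.2.1 s.2.2.1.2 * ψ s.2.1 s.2.2.2.1 * _), ← h5, dotProduct, dotProduct,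
        Fintype.sum_prod_type, Finset.sum_mul]
      refine Finset.sum_congr rfl fun a _ => ?_
      rw [Finset.mul_sum, Finset.mul_sum]
      refine Finset.sum_congr rfl fun z _ => ?_
      simp only [Pi.star_apply, star_mul']
      ring
    rw [reflection_mulVec, hdot, labelReflection, if_pos hc, sub_mulVec, smul_mulVec, one_mulVec]
    simp only [Pi.sub_apply, Pi.smul_apply, smul_eq_mul, hidProj_mulVec]
    ring
  · rw [if_neg (show ¬ (sndLabelEquiv s).2.1.1 = 0 from hc), one_mulVec, labelReflection,
      if_neg hc, one_mulVec]
    rfl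

theorem trace_mul_eq_sum_of_isPurification {A B : Type} [Fintype A] [Fintype B]
    {τ : Matrix A A ℂ} {ψ : A × B → ℂ} (h : IsPurification τ ψ) (M : Matrix A A ℂ) :
    trace (M * τ) = ∑ b, (star fun a => ψ (a, b)) ⬝ᵥ (M *ᵥ fun a => ψ (a, b)) := by
  have h1 : τ = ∑ b, ketbra fun a => ψ (a, b) := by
    ext a a'
    rw [← h a a', Matrix.sum_apply]
    rfl
  rw [h1, Finset.mul_sum, trace_sum]
  exact Finset.sum_congr rfl fun b _ => trace_mul_ketbra _ _

/-- The Pauli X on the control leaves only the cross terms between its two branches. -/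
theorem star_dotProduct_kronecker_mulVec (O : Matrix (Full n h) (Full n h) ℂ)
    (v : EuclideanSpace ℂ (Qubits n)) (f : Fin 2 → Hid h → ℂ) (a : ℂ) :
    (star fun r : Fin 2 × Full n h => a * (v r.2.1 * f r.1 r.2.2)) ⬝ᵥ
      ((!![0, 1; 1, 0] ⊗ₖ O) *ᵥ fun r => a * (v r.2.1 * f r.1 r.2.2)) =
    star a * a * (star (f 0) ⬝ᵥ (condHarmony O v *ᵥ f 1) +
      star (f 1) ⬝ᵥ (condHarmony O v *ᵥ f 0)) := by
  have h1 : ∀ c, (fun t : Full n h => a * (v t.1 * f c t.2)) = a • (dataIsometry h v *ᵥ f c) := by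
    intro c
    ext t
    rw [Pi.smul_apply, mulVec, dotProduct, Finset.sum_eq_single t.2]
    · simp [dataIsometry]
    · intro y _ hy
      simp [dataIsometry, Ne.symm hy]
    · simp
  have h2 : ∀ c c', (star fun t : Full n h => a * (v t.1 * f c t.2)) ⬝ᵥ
      (O *ᵥ fun t => a * (v t.1 * f c' t.2)) =
      star a * a * (star (f c) ⬝ᵥ (condHarmony O v *ᵥ f c')) := by
    intro c c'
    rw [h1, h1, star_smul, smul_dotProduct, mulVec_smul, dotProduct_smul, star_mulVec,
      ← dotProduct_mulVec, mulVec_mulVec, mulVec_mulVec, ← condHarmony_eq]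
    simp only [smul_eq_mul]
    ring
  have h3 : ∀ (φ : Fin 2 × Full n h → ℂ) (c : Fin 2) (t : Full n h),
      ((!![0, 1; 1, 0] ⊗ₖ O) *ᵥ φ) (c, t) = (O *ᵥ fun t' => φ (1 - c, t')) t := by
    intro φ c t
    rw [mulVec, dotProduct, Fintype.sum_prod_type, Fin.sum_univ_two]
    fin_cases c <;> simp [mulVec, dotProduct, kroneckerMap_apply]
  rw [dotProduct, Fintype.sum_prod_type, Fin.sum_univ_two]
  simp only [h3]
  exact (congrArg₂ (· + ·) (h2 0 1) (h2 1 0)).trans (mul_add _ _ _).symm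

theorem star_mulVec_dotProduct_of_isHermitian {A : Type} [Fintype A] {M : Matrix A A ℂ}
    (hM : M.IsHermitian) (x y : A → ℂ) : star (M *ᵥ x) ⬝ᵥ y = star x ⬝ᵥ (M *ᵥ y) := by
  rw [star_mulVec, hM, ← dotProduct_mulVec]

theorem sum_star_mul_mulVec_of_isPurification {A B : Type} [Fintype A] [Fintype B]
    {τ : Matrix A A ℂ} {ψ : A × B → ℂ} (h : IsPurification τ ψ) (M : Matrix A A ℂ) :
    ∑ y, star (ψ y) * (M *ᵥ fun a => ψ (a, y.2)) y.1 = trace (M * τ) := by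
  rw [trace_mul_eq_sum_of_isPurification h, Fintype.sum_prod_type_right]
  rfl

theorem sum_star_mulVec_mul_of_isPurification {A B : Type} [Fintype A] [Fintype B]
    {τ : Matrix A A ℂ} {ψ : A × B → ℂ} (h : IsPurification τ ψ) {M : Matrix A A ℂ}
    (hM : M.IsHermitian) :
    ∑ y, star ((M *ᵥ fun a => ψ (a, y.2)) y.1) * ψ y = trace (M * τ) := by
  rw [trace_mul_eq_sum_of_isPurification h, Fintype.sum_prod_type_right]
  exact Finset.sum_congr rfl fun b _ =>
    star_mulVec_dotProduct_of_isHermitian hM (fun a => ψ (a, b)) fun a => ψ (a, b)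

/-- The first Gibbs copy is untouched, while the second carries L 0 = 2P - 1 or L 1 = 1 according to
the first control. If the second control is 0, the observable acts on the second copy, and the cross
terms give 2 Tr(L 0 C τ). If it is 1, the observable acts on the first copy with a minus sign, and
independence of the copies gives -2 Tr(C τ) Tr(L 0 τ). -/
theorem star_dotProduct_covObs_mulVec {Φ : PurifiedReg n h K d → ℂ}
    (hΦ : ∀ s, Φ s = ((1 / Real.sqrt (4 * K) : ℝ) : ℂ) * v s.2.1 s.2.2.1.1 * ℓ s.2.1 s.2.2.1.2 *
        ψ s.2.1 s.2.2.2.1 *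
        (labelReflection h (ℓ s.2.1) s.1.1 *ᵥ fun y => ψ s.2.1 (y, s.2.2.2.2.2)) s.2.2.2.2.1)
    (hℓ : ∀ k, ‖ℓ k‖ = 1)
    (hψ : ∀ k, IsPurification (τ k) (ψ k)) (hτ : ∀ k, trace (τ k) = 1)
    {O : Matrix (Full n h) (Full n h) ℂ} (hc : ∀ k, Commute (labelProj n h (ℓ k)) O) (hK : 0 < K) :
    star Φ ⬝ᵥ covObs K d O *ᵥ Φ =
    (1 / (K : ℂ)) * ∑ k, (trace (hidProj h (ℓ k) * condHarmony O (v k) * τ k) -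
      trace (hidProj h (ℓ k) * τ k) * trace (condHarmony O (v k) * τ k)) := by
  set κ : ℂ := ((1 / Real.sqrt (4 * K) : ℝ) : ℂ) with hκ
  have hκκ : star κ * κ = 1 / (4 * K) := by
    rw [hκ, ← starRingEnd_apply, Complex.conj_ofReal, ← Complex.ofReal_mul, div_mul_div_comm,
      Real.mul_self_sqrt (by positivity)]
    push_cast
    ring
  rw [covObs, star_dotProduct_blockOp_mulVec, Fintype.sum_prod_type, Fin.sum_univ_two,
    Fintype.sum_prod_type, Fintype.sum_prod_type, ← Finset.sum_add_distrib, Finset.mul_sum]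
  refine Finset.sum_congr rfl fun k _ => ?_
  set p := hidProj h (ℓ k)
  set C := condHarmony O (v k)
  set L := labelReflection h (ℓ k) with hL
  have hL1 : L 1 = 1 := rfl
  have hL0 : L 0 = (2 : ℂ) • p - 1 := rfl
  have hp : pᴴ = p := hidProj_isHermitian h (ℓ k)
  have hLh : (L 0).IsHermitian := by
    rw [hL0, IsHermitian, conjTranspose_sub, conjTranspose_smul, hp]
    simp
  -- Commutation makes the two cross terms on the second copy equal.
  have hLC : C * L 0 = L 0 * C := by
    rw [hL0, mul_sub, sub_mul, Matrix.mul_smul, Matrix.smul_mul,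
      (commute_hidProj_condHarmony (hc k) (v k)).eq, one_mul, mul_one]
  set ψb : Fin d → Hid h → ℂ := fun b y => ψ k (y, b) with hψb
  have sℓ : ∑ l, star (ℓ k l) * ℓ k l = 1 := star_dotProduct_of_norm_eq_one (hℓ k)
  have sψ : ∑ y, star (ψ k y) * ψ k y = 1 := by
    have := trace_mul_eq_sum_of_isPurification (hψ k) 1
    rw [one_mul, hτ] at this
    rw [this, Fintype.sum_prod_type_right]
    simp only [one_mulVec]
    rfl
  have sC : ∑ b, star (ψb b) ⬝ᵥ C *ᵥ ψb b = trace (C * τ k) :=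
    (trace_mul_eq_sum_of_isPurification (hψ k) C).symm
  have sLC : ∑ b, star (ψb b) ⬝ᵥ (L 0 * C) *ᵥ ψb b = trace (L 0 * C * τ k) :=
    (trace_mul_eq_sum_of_isPurification (hψ k) _).symm
  have sL : ∑ y : Hid h × Fin d, star (ψ k y) * (L 0 *ᵥ ψb y.2) y.1 = trace (L 0 * τ k) :=
    sum_star_mul_mulVec_of_isPurification (hψ k) _
  have sL' : ∑ y : Hid h × Fin d, star ((L 0 *ᵥ ψb y.2) y.1) * ψ k y = trace (L 0 * τ k) :=
    sum_star_mulVec_mul_of_isPurification (hψ k) hLh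
  have hΦ0 : ∀ (l : Fin 2) (b : Fin d) (y : Hid h × Fin d),
      (fun r => Φ (obsEquiv.symm (r, (0, k, l, b, y)))) =
      fun r => (κ * ℓ k l * ψ k y) * (v k r.2.1 * (fun c => L c *ᵥ ψb b) r.1 r.2.2) := by
    intro l b y
    ext r
    rw [hΦ]
    simp only [obsEquiv, Equiv.coe_fn_symm_mk, if_true]
    ring
  have hΦ1 : ∀ (l : Fin 2) (b : Fin d) (y : Hid h × Fin d),
      (fun r => Φ (obsEquiv.symm (r, (1, k, l, b, y)))) =
      fun r => (κ * ℓ k l) * (v k r.2.1 *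
        (fun c => ((L c *ᵥ ψb y.2) y.1) • ψb b) r.1 r.2.2) := by
    intro l b y
    ext r
    rw [hΦ]
    simp only [obsEquiv, Equiv.coe_fn_symm_mk, one_ne_zero, if_false, Pi.smul_apply, smul_eq_mul]
    ring
  have hA : ∀ (l : Fin 2) (b : Fin d) (y : Hid h × Fin d),
      (star fun r => Φ (obsEquiv.symm (r, (0, k, l, b, y)))) ⬝ᵥ
      (((if (0 : Fin 2) = 0 then 1 else -1 : ℂ) • (!![0, 1; 1, 0] ⊗ₖ O)) *ᵥ
        fun r => Φ (obsEquiv.symm (r, (0, k, l, b, y)))) =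
      (2 * (star κ * κ)) * ((star (ℓ k l) * ℓ k l) *
        ((star (ψb b) ⬝ᵥ (L 0 * C) *ᵥ ψb b) * (star (ψ k y) * ψ k y))) := by
    intro l b y
    rw [hΦ0, if_pos rfl, one_smul]
    refine (star_dotProduct_kronecker_mulVec O (v k) (fun c => L c *ᵥ ψb b)
      (κ * ℓ k l * ψ k y)).trans ?_
    simp only [hL1, one_mulVec, star_mulVec_dotProduct_of_isHermitian hLh, mulVec_mulVec, star_mul']
    rw [show condHarmony O (v k) * L 0 = L 0 * C from hLC]
    ring
  have hB : ∀ (l : Fin 2) (b : Fin d) (y : Hid h × Fin d),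
      (star fun r => Φ (obsEquiv.symm (r, (1, k, l, b, y)))) ⬝ᵥ
      (((if (1 : Fin 2) = 0 then 1 else -1 : ℂ) • (!![0, 1; 1, 0] ⊗ₖ O)) *ᵥ
        fun r => Φ (obsEquiv.symm (r, (1, k, l, b, y)))) =
      (-(star κ * κ)) * ((star (ℓ k l) * ℓ k l) *
        ((star (ψb b) ⬝ᵥ C *ᵥ ψb b) * (star ((L 0 *ᵥ ψb y.2) y.1) * ψ k y +
          star (ψ k y) * (L 0 *ᵥ ψb y.2) y.1))) := by
    intro l b y
    rw [hΦ1, if_neg one_ne_zero, smul_mulVec, dotProduct_smul]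
    refine (congrArg ((-1 : ℂ) • ·) (star_dotProduct_kronecker_mulVec O (v k)
      (fun c => ((L c *ᵥ ψb y.2) y.1) • ψb b) (κ * ℓ k l))).trans ?_
    simp only [hL1, one_mulVec, star_smul, smul_dotProduct, mulVec_smul, dotProduct_smul,
      smul_eq_mul, star_mul']
    change _ = -(star κ * κ) * ((star (ℓ k l) * ℓ k l) *
        ((star (ψb b) ⬝ᵥ C *ᵥ ψb b) * (star ((L 0 *ᵥ ψb y.2) y.1) * ψb y.2 y.1 +
          star (ψb y.2 y.1) * (L 0 *ᵥ ψb y.2) y.1)))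
    ring
  have hA' : ∑ t : Fin 2 × Fin d × (Hid h × Fin d), (2 * (star κ * κ)) *
      ((star (ℓ k t.1) * ℓ k t.1) * ((star (ψb t.2.1) ⬝ᵥ (L 0 * C) *ᵥ ψb t.2.1) *
        (star (ψ k t.2.2) * ψ k t.2.2))) = (2 * (star κ * κ)) * trace (L 0 * C * τ k) := by
    rw [← Finset.mul_sum, Fintype.sum_prod_type]
    simp only [← Finset.mul_sum, Fintype.sum_prod_type (γ := ℂ) (α₁ := Fin d)
      (α₂ := Hid h × Fin d), sψ, mul_one, sLC, ← Finset.sum_mul, sℓ, one_mul]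
  have hB' : ∑ t : Fin 2 × Fin d × (Hid h × Fin d), (-(star κ * κ)) *
      ((star (ℓ k t.1) * ℓ k t.1) * ((star (ψb t.2.1) ⬝ᵥ C *ᵥ ψb t.2.1) *
        (star ((L 0 *ᵥ ψb t.2.2.2) t.2.2.1) * ψ k t.2.2 +
          star (ψ k t.2.2) * (L 0 *ᵥ ψb t.2.2.2) t.2.2.1))) =
      (-(star κ * κ)) * (trace (C * τ k) * (2 * trace (L 0 * τ k))) := by
    rw [← Finset.mul_sum, Fintype.sum_prod_type]
    simp only [← Finset.mul_sum, Fintype.sum_prod_type (γ := ℂ) (α₁ := Fin d)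
      (α₂ := Hid h × Fin d), Finset.sum_add_distrib, sL, sL', sC, ← Finset.sum_mul, sℓ, one_mul]
    ring
  have hK' : (K : ℂ) ≠ 0 := by exact_mod_cast hK.ne'
  refine (congrArg₂ (· + ·) ((Finset.sum_congr rfl fun t _ => hA t.1 t.2.1 t.2.2).trans hA')
    ((Finset.sum_congr rfl fun t _ => hB t.1 t.2.1 t.2.2).trans hB')).trans ?_
  -- The contributions Tr(C τ) of the -1 in L 0 cancel between the two traces; the prefactor 4/(4K)
  -- leaves 1/K.
  have e1 : trace (L 0 * C * τ k) = 2 * trace (p * C * τ k) - trace (C * τ k) := by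
    rw [hL0, sub_mul, sub_mul, trace_sub, one_mul, Matrix.smul_mul, Matrix.smul_mul, trace_smul,
      smul_eq_mul]
  have e2 : trace (L 0 * τ k) = 2 * trace (p * τ k) - 1 := by
    rw [hL0, sub_mul, trace_sub, one_mul, Matrix.smul_mul, trace_smul, smul_eq_mul, hτ]
  simp only [e1, e2, hκκ]
  field_simp
  ring

theorem isChannel_purifiedOracle {d : ℕ}
    {G : Matrix (Fin K × (Hid h × Fin d)) (Fin K × (Hid h × Fin d)) ℂ} (hF : IsDataOracle v ℓ F)
    (hG : G ∈ Matrix.unitaryGroup (Fin K × (Hid h × Fin d)) ℂ) (q : PurifiedQuery) :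
    (purifiedOracle F G q).IsChannel := by
  have hcF : (coherent F)ᴴ * coherent F = 1 :=
    coherent_conjTranspose_mul_self fun k => Matrix.mem_unitaryGroup_iff'.1 (hF k).1
  cases q with
  | F => exact ⟨inferInstance, hcF⟩
  | Finv =>
    refine ⟨inferInstance, ?_⟩
    rw [conjTranspose_conjTranspose]
    exact mul_eq_one_comm.1 hcF
  | G => exact ⟨inferInstance, Matrix.mem_unitaryGroup_iff'.1 hG⟩
  | Ginv =>
    refine ⟨inferInstance, ?_⟩
    rw [conjTranspose_conjTranspose]
    exact Matrix.mem_unitaryGroup_iff.1 hG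

end Purified

/-- Expectation values of a Hermitian unitary have modulus at most one. -/
theorem sq_amplitude_le_one {S : Type} [Fintype S] [DecidableEq S] {z : Matrix S S ℂ}
    (hz : z.IsHermitian) (hz' : zᴴ * z = 1) {φ : S → ℂ} (hφ : star φ ⬝ᵥ φ = 1) {c : ℝ}
    (hc : (c : ℂ) = star φ ⬝ᵥ z *ᵥ φ) : c ^ 2 ≤ 1 := by
  -- A program without oracles that measures z: its output has mean c and second moment 1.
  obtain ⟨E, -, hE⟩ := QProgram.exists_hasLaw_prep (R := fun _ : Empty => Empty)
    (ans := fun q => q.elim) (fun q => q.elim) φ hφ (.measureObs hz)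
  have h1 : E id = c := by
    rw [← Complex.ofReal_inj, hE, QProgram.expect_measureObs_id, trace_mul_ketbra, hc]
  have h2 : E (fun x => x ^ 2) = 1 := by
    rw [hz] at hz'
    rw [← Complex.ofReal_inj, hE, QProgram.expect_measureObs_sq, hz', one_mul, trace_ketbra, hφ,
      Complex.ofReal_one]
  rw [← h1, ← h2]
  exact E.sq_map_id_le

/-- The gradient can be approximated from purified Gibbs states. -/
theorem exists_purifiedAlgorithm {D n h K d : ℕ} [NeZero d] (hK : 0 < K) {ε : ℝ} (hε : 0 < ε)
    (H : Fin D → Matrix (Full n h) (Full n h) ℂ) (hH : ∀ i, (H i).IsHermitian)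
    (hH' : ∀ i, H i ∈ Matrix.unitaryGroup (Full n h) ℂ) :
    ∃ 𝒜 : QueryAlgorithm (PurifiedQuery.reg n h K d) (EuclideanSpace ℝ (Fin D)),
      (𝒜.queries : ℝ) ≤ 160 * ((D : ℝ) ^ 2 / ε) ∧
      ∀ (ω : Fin D → ℝ) (v : Fin K → EuclideanSpace ℂ (Qubits n))
        (ℓ : Fin K → EuclideanSpace ℂ (Fin 2)),
        (∀ k, ‖v k‖ = 1) → (∀ k, ‖ℓ k‖ = 1) →
        (∀ k i, Commute (labelProj n h (ℓ k)) (H i)) →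
        ∀ F : Fin K → Matrix (Qubits n × Fin 2) (Qubits n × Fin 2) ℂ, IsDataOracle v ℓ F →
        ∀ G : Matrix (Fin K × (Hid h × Fin d)) (Fin K × (Hid h × Fin d)) ℂ,
          IsPurifiedOracle (fun k => gibbs (condHarmony (harmony H ω) (v k))) G →
          2 / 3 ≤ 𝒜.prob (purifiedOracle F G) (approximations (gradVec H ω v ℓ) ε) := by
  have hHH : ∀ i, H i * H i = 1 := fun i => by
    have := Matrix.mem_unitaryGroup_iff.1 (hH' i)
    rwa [star_eq_conjTranspose, hH i] at this
  have hz := fun i => covObs_isHermitian (K := K) (d := d) (hH i)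
  have hz' := fun i => covObs_conjTranspose_mul_self (K := K) (d := d) (hH i) (hHH i)
  have hχ := star_startVec_dotProduct (n := n) (h := h) (d := d) hK
  -- Provides the index 0 in the starting basis state.
  have : NeZero K := ⟨hK.ne'⟩
  -- As amplitudes of a Hermitian unitary, the components have modulus at most 1, so the zero vector
  -- is good enough here. Otherwise ε² < 3D ≤ 4D².
  by_cases hbig : 3 * (D : ℝ) ≤ ε ^ 2
  · obtain ⟨𝒜, hq, h𝒜⟩ := exists_queryAlgorithm (0 : Fin 1)
      (fun _ : Fin D => (.output 0 : QProgram (Fin 1) (PurifiedQuery.reg n h K d) ℝ))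
      (m := 0) (fun _ => le_refl 0) hε
    refine ⟨𝒜, ?_, ?_⟩
    · have : 𝒜.queries = 0 := by simpa using hq
      rw [this, Nat.cast_zero]
      positivity
    intro ω v ℓ hv hℓ hc F hF G ⟨hG, ψ, hψ⟩
    obtain ⟨g, hg, hgi⟩ := gradVec_eq hH ω hv hc
    rw [hg]
    refine h𝒜 _ _ g (fun i => QProgram.hasLaw_output 0) ?_
    have hU := isUnitary_prepUnitary hF (Matrix.mem_unitaryGroup_iff'.1 hG)
    have : ∀ i, g i ^ 2 ≤ 1 := fun i => by
      refine sq_amplitude_le_one (hz i) (hz' i) ((star_mulVec_dotProduct hU _).trans hχ) ?_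
      rw [hgi i, star_dotProduct_covObs_mulVec
        (prepUnitary_mulVec hF hv fun k => (hψ k).2) hℓ (fun k => (hψ k).1)
        (fun k => trace_gibbs (condHarmony_isHermitian (harmony_isHermitian hH ω) (v k)))
        (fun k => hc k i) hK]
    calc _ ≤ ∑ _i : Fin D, (1 : ℝ) := Finset.sum_le_sum fun i _ => by simpa using this i
      _ ≤ ε ^ 2 / 3 := by simp; linarith
  · push Not at hbig
    have hD0 : 0 < D := by
      rcases Nat.eq_zero_or_pos D with h0 | h0
      · rw [h0] at hbig
        norm_num at hbig
        nlinarith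
      · exact h0
    have hD : (1 : ℝ) ≤ D := by exact_mod_cast hD0
    have hε2 : ε ≤ 2 * D := by nlinarith
    have hDε : 1 / 2 ≤ D / ε := by rw [div_le_div_iff₀ two_pos hε]; linarith
    -- The total error 60D/M² is at most ε²/3 once 180D ≤ (εM)², and 14² = 196 suffices since D ≥ 1.
    -- As D/ε ≥ 1/2, rounding up costs at most 2D/ε. With 10 queries in each round and D components
    -- the constant is 160.
    set M := ⌈14 * (D / ε)⌉₊
    have hM1 : 14 * (D / ε) ≤ M := Nat.le_ceil _
    have hM2 : (M : ℝ) ≤ 16 * (D / ε) := by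
      have := Nat.ceil_lt_add_one (show 0 ≤ 14 * (D / ε) by positivity)
      linarith
    have hM : 2 ≤ M := by
      have : (2 : ℝ) ≤ M := by linarith
      exact_mod_cast this
    obtain ⟨𝒜, hq, h𝒜⟩ := exists_queryAlgorithm
      (S := PurifiedReg n h K d × Fin (M + 1)) (((0, 0), 0, (0, 0), (0, 0), (0, 0)), 0)
      (fun i => estimateAmplitude hM (prepForward n h K d (M + 1)) (prepBackward n h K d (M + 1))
        (hz' i) hχ) (fun i => queries_estimateAmplitude_le hM (hz' i) hχ
          (queries_prepForward_le _) (queries_prepBackward_le _)) hε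
    refine ⟨𝒜, ?_, ?_⟩
    · have : (𝒜.queries : ℝ) ≤ D * (M * 10) := by exact_mod_cast hq
      calc (𝒜.queries : ℝ) ≤ D * (M * 10) := this
        _ ≤ D * ((16 * (D / ε)) * 10) := by gcongr
        _ = 160 * ((D : ℝ) ^ 2 / ε) := by ring
    intro ω v ℓ hv hℓ hc F hF G ⟨hG, ψ, hψ⟩
    obtain ⟨g, hg, hgi⟩ := gradVec_eq hH ω hv hc
    rw [hg]
    have hU := isUnitary_prepUnitary hF (Matrix.mem_unitaryGroup_iff'.1 hG)
    have : ∀ i, ∃ E, (estimateAmplitude hM (prepForward n h K d (M + 1))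
        (prepBackward n h K d (M + 1)) (hz' i) hχ).HasLaw (purifiedOracle F G) E ∧
        E (fun x => (x - g i) ^ 2) ≤ 60 / (M : ℝ) ^ 2 := fun i => by
      refine exists_hasLaw_estimateAmplitude (isChannel_purifiedOracle hF hG) hM hU
        (implements_prepForward _) (implements_prepBackward _) (hz' i) (hz i) hχ ?_
      rw [hgi i, star_dotProduct_covObs_mulVec
        (prepUnitary_mulVec hF hv fun k => (hψ k).2) hℓ (fun k => (hψ k).1)
        (fun k => trace_gibbs (condHarmony_isHermitian (harmony_isHermitian hH ω) (v k)))
        (fun k => hc k i) hK]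
    choose E hE hV using this
    refine h𝒜 _ E g hE ((Finset.sum_le_sum fun i _ => hV i).trans ?_)
    rw [Finset.sum_const, Finset.card_univ, Fintype.card_fin, nsmul_eq_mul, ← mul_div_assoc,
      div_le_div_iff₀ (by positivity) three_pos]
    have h1 : (14 * D) ^ 2 ≤ (ε * M) ^ 2 := by
      refine pow_le_pow_left₀ (by positivity) ?_ 2
      have := mul_le_mul_of_nonneg_left hM1 hε.le
      rwa [mul_left_comm, mul_div_cancel₀ _ hε.ne'] at this
    nlinarith

end

theorem mainTheorem4 :
    (∃ C : ℝ, 0 < C ∧ ∀ (D n h K : ℕ), 0 < K → ∀ (ε : ℝ), 0 < ε →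
      ∀ H : Fin D → Matrix (Full n h) (Full n h) ℂ,
      (∀ i, (H i).IsHermitian) → (∀ i, H i ∈ Matrix.unitaryGroup (Full n h) ℂ) →
      ∃ 𝒜 : QueryAlgorithm (SampleQuery.reg n h (K := K)) (EuclideanSpace ℝ (Fin D)),
        (𝒜.queries : ℝ) ≤ C * ((D : ℝ) ^ 2 / ε ^ 2) ∧
        ∀ (ω : Fin D → ℝ) (v : Fin K → EuclideanSpace ℂ (Qubits n))
          (ℓ : Fin K → EuclideanSpace ℂ (Fin 2)),
          (∀ k, ‖v k‖ = 1) → (∀ k, ‖ℓ k‖ = 1) →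
          (∀ k i, Commute (labelProj n h (ℓ k)) (H i)) →
          ∀ F : Fin K → Matrix (Qubits n × Fin 2) (Qubits n × Fin 2) ℂ, IsDataOracle v ℓ F →
            2 / 3 ≤ 𝒜.prob (sampleOracle F fun k => gibbs (condHarmony (harmony H ω) (v k)))
              (approximations (gradVec H ω v ℓ) ε)) ∧
    (∃ C : ℝ, 0 < C ∧ ∀ (D n h K d : ℕ) [NeZero d], 0 < K → ∀ (ε : ℝ), 0 < ε →
      ∀ H : Fin D → Matrix (Full n h) (Full n h) ℂ,
      (∀ i, (H i).IsHermitian) → (∀ i, H i ∈ Matrix.unitaryGroup (Full n h) ℂ) →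
      ∃ 𝒜 : QueryAlgorithm (PurifiedQuery.reg n h K d) (EuclideanSpace ℝ (Fin D)),
        (𝒜.queries : ℝ) ≤ C * ((D : ℝ) ^ 2 / ε) ∧
        ∀ (ω : Fin D → ℝ) (v : Fin K → EuclideanSpace ℂ (Qubits n))
          (ℓ : Fin K → EuclideanSpace ℂ (Fin 2)),
          (∀ k, ‖v k‖ = 1) → (∀ k, ‖ℓ k‖ = 1) →
          (∀ k i, Commute (labelProj n h (ℓ k)) (H i)) →
          ∀ F : Fin K → Matrix (Qubits n × Fin 2) (Qubits n × Fin 2) ℂ, IsDataOracle v ℓ F →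
          ∀ G : Matrix (Fin K × (Hid h × Fin d)) (Fin K × (Hid h × Fin d)) ℂ,
            IsPurifiedOracle (fun k => gibbs (condHarmony (harmony H ω) (v k))) G →
            2 / 3 ≤ 𝒜.prob (purifiedOracle F G)
              (approximations (gradVec H ω v ℓ) ε)) :=
  ⟨⟨240, by norm_num, fun _ _ _ _ hK _ hε H hH hH' => exists_sampleAlgorithm hK hε H hH hH'⟩,
    ⟨160, by norm_num, fun _ _ _ _ _ _ hK _ hε H hH hH' =>
      exists_purifiedAlgorithm hK hε H hH hH'⟩⟩
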